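/- **Session types.** Let $\mathsf{Tags}$ be a set. Session types are the regular (finitely many distinct subtrees), possibly infinite trees $$S,T ::= \mathbf 1 \mid \bot \mid \oplus\{a_i:S_i\}_{i\in I} \mid \&\{a_i:S_i\}_{i\in I} \mid S\otimes T \mid S\mathbin{\wp} T,$$ where $I$ is finite and nonempty and the $a_i\in\mathsf{Tags}$ are pairwise distinct. Write $\mathsf{pos}(S)$ if the root of $S$ is $\mathbf 1$, $\oplus$ or $\otimes$. Messages $\sigma$ are $*$, tags and session types; labels $\alpha$ are $!\sigma$ (output) and $?\sigma$ (input). **Transitions.** The *axioms* are $\mathbf 1\xrightarrow{!*}\mathbf 1$, $\bot\xrightarrow{?*}\bot$, $\oplus\{a_i:S_i\}_{i\in I}\xrightarrow{!a_k}S_k$ and $\&\{a_i:S_i\}_{i\in I}\xrightarrow{?a_k}S_k$ for $k\in I$, $S\otimes T\xrightarrow{!S}T$, and $S\mathbin{\wp} T\xrightarrow{?S}T$. The *rules* are: from $S_i\xrightarrow{?\sigma}T_i$ for all $i\in I$ infer $\oplus\{a_i:S_i\}_{i\in I}\xrightarrow{?\sigma}\oplus\{a_i:T_i\}_{i\in I}$;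 from $S_i\xrightarrow{!\sigma}T_i$ for all $i\in I$ infer $\&\{a_i:S_i\}_{i\in I}\xrightarrow{!\sigma}\&\{a_i:T_i\}_{i\in I}$; from $S\xrightarrow{?\sigma}T$ infer $U\otimes S\xrightarrow{?\sigma}U\otimes T$; from $S\xrightarrow{!\sigma}T$ infer $U\mathbin{\wp} S\xrightarrow{!\sigma}U\mathbin{\wp} T$. The *corules* are the first two rules with the single premise for one $k\in I$. Then $S\xrightarrow{\alpha}T$ holds if it has a possibly infinite derivation with axioms and rules, every judgment of which has a finite derivation with axioms, rules and corules. **Correct composition and subtyping.** *Correct asynchronous composition* is the largest relation $\mathcal R$ on session types such that $(S,T)\in\mathcal R$ implies: (1) $\mathsf{pos}(S)$ or $\mathsf{pos}(T)$; (2) if $S\xrightarrow{!\sigma}S'$ with $\sigma\in\{*\}\cup\mathsf{Tags}$, then $T\xrightarrow{?\sigma}T'$ for some $T'$ with $(S',T')\in\mathcal R$; (3) if $T\xrightarrow{!\sigma}T'$ with $\sigma\in\{*\}\cup\mathsf{Tags}$, then $S\xrightarrow{?\sigma}S'$ for some $S'$ with $(S',T')\in\mathcal R$; (4) if $S\xrightarrow{!S_1}S_2$,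 then $T\xrightarrow{?T_1}T_2$ for some $T_1,T_2$ with $(S_1,T_1),(S_2,T_2)\in\mathcal R$; (5) if $T\xrightarrow{!T_1}T_2$, then $S\xrightarrow{?S_1}S_2$ for some $S_1,S_2$ with $(S_1,T_1),(S_2,T_2)\in\mathcal R$. *Fair asynchronous subtyping* $S\leqslant T$ holds if every session type that is correctly composed with $T$ is correctly composed with $S$. **Queue machines.** A queue machine $M=(Q,\Sigma,\Gamma,\$,s,\delta)$ has a finite set $Q$ of states, a finite queue alphabet $\Gamma\subseteq\mathsf{Tags}$, an input alphabet $\Sigma\subseteq\Gamma$, an initial queue symbol $\$\in\Gamma\setminus\Sigma$, a start state $s\in Q$ and a transition function $\delta:Q\times\Gamma\to Q\times\Gamma^*$. On configurations in $Q\times\Gamma^*$ put $(p,A\alpha)\to_M(q,\alpha\gamma)$ whenever $\delta(p,A)=(q,\gamma)$. $M$ accepts $x\in\Sigma^*$ if $(s,x\$)\to_M^*(q,\varepsilon)$ for some $q\in Q$. Define session types by $Q^M=\&\{A:\oplus\{A:Q^M\}\}_{A\in\Gamma}$, $Q^M_{X_1\cdots X_n}=\oplus\{X_1:\cdots\oplus\{X_n:Q^M\}\}$,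 and, for $q\in Q$, $S^M_q=\&\{A:\oplus\{B_1:\cdots\oplus\{B_n:S^M_{q'}\}\}\}_{A\in\Gamma}$ where $\delta(q,A)=(q',B_1\cdots B_n)$. **Theorem.** (a) For every queue machine $M$ and every $x\in\Sigma^*$, $M$ accepts $x$ if and only if $Q^M_{x\$}$ and $S^M_s$ are not correctly composed. (b) Let $\mathsf{Tags}$ be infinite and effectively coded by natural numbers. Correct asynchronous composition is undecidable: there is no algorithm that, given two session types, each presented by a finite system of equations with a chosen initial equation, decides whether they are correctly composed. (c) Under the same assumption on $\mathsf{Tags}$, fair asynchronous subtyping is undecidable in the same sense. -/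

import Mathlib

namespace AsyncSession

/-! ## Session types: regular trees -/

/-- The root of a session type, over a set `Tag` of tags. A branching node carries the finite
nonempty set of its tags. -/
inductive Shape (Tag : Type) : Type
  | one
  | bot
  | plus (I : Finset Tag) (hI : I.Nonempty)
  | wth (I : Finset Tag) (hI : I.Nonempty)
  | tensor
  | par

/-- Index type of the children: one child per tag below a branching node, two children
(`false` = payload, `true` = continuation) below `⊗` and `⅋`. -/
abbrev Shape.Child {Tag : Type} : Shape Tag → Type
  | .one => Empty
  | .bot => Empty
  | .plus I _ => {a // a ∈ I}
  | .wth I _ => {a // a ∈ I}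
  | .tensor => Bool
  | .par => Bool

/-- One layer of a session type. -/
abbrev layer (Tag : Type) : PFunctor := ⟨Shape Tag, Shape.Child⟩

/-- Possibly infinite trees. -/
abbrev Tree (Tag : Type) : Type := (layer Tag).M

variable {Tag : Type}

/-- `s` is an immediate subtree of `t`. -/
def Tree.IsChild (t s : Tree Tag) : Prop := ∃ b, (PFunctor.M.dest t).2 b = s

/-- A tree is regular if it has finitely many distinct subtrees. -/
def Tree.Regular (t : Tree Tag) : Prop := {s | Relation.ReflTransGen Tree.IsChild t s}.Finite

instance Shape.finite_child (s : Shape Tag) : Finite s.Child := by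
  cases s <;> unfold Shape.Child <;> infer_instance

theorem Tree.regular_of_closed {t : Tree Tag} (A : Set (Tree Tag)) (hA : A.Finite) (ht : t ∈ A)
    (hc : ∀ u ∈ A, ∀ v, Tree.IsChild u v → v ∈ A) : t.Regular := by
  refine hA.subset ?_
  intro s hs
  induction hs with
  | refl => exact ht
  | tail _ h ih => exact hc _ ih _ h

theorem Tree.Regular.mk {a : Shape Tag} {f : a.Child → Tree Tag} (h : ∀ b, (f b).Regular) :
    Tree.Regular (PFunctor.M.mk (F := layer Tag) ⟨a, f⟩) := by
  refine Tree.regular_of_closed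
    (insert (PFunctor.M.mk (F := layer Tag) ⟨a, f⟩)
      (⋃ b, {s | Relation.ReflTransGen Tree.IsChild (f b) s}))
    ((Set.finite_iUnion h).insert _) (Set.mem_insert _ _) ?_
  rintro u (rfl | hu) v ⟨b, hb⟩
  · right
    refine Set.mem_iUnion.2 ⟨b, ?_⟩
    change f b = v at hb
    exact hb ▸ Relation.ReflTransGen.refl
  · right
    obtain ⟨c, hc⟩ := Set.mem_iUnion.1 hu
    exact Set.mem_iUnion.2 ⟨c, Relation.ReflTransGen.tail hc ⟨b, hb⟩⟩

/-- Session types: regular, possibly infinite trees. -/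
def SessionType (Tag : Type) : Type := {t : Tree Tag // t.Regular}

namespace SessionType

/-- The session type with root `a` and children `f`. -/
def mk (a : Shape Tag) (f : a.Child → SessionType Tag) : SessionType Tag :=
  ⟨PFunctor.M.mk (F := layer Tag) ⟨a, fun b => (f b).1⟩, Tree.Regular.mk fun b => (f b).2⟩

/-- `1`: send a termination signal. -/
def one : SessionType Tag := mk .one Empty.elim

/-- `⊥`: receive a termination signal. -/
def bot : SessionType Tag := mk .bot Empty.elim

/-- `⊕{a : f a}_{a ∈ I}`: send a tag. -/
def plus (I : Finset Tag) (hI : I.Nonempty) (f : {a // a ∈ I} → SessionType Tag) :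
    SessionType Tag := mk (.plus I hI) f

/-- `&{a : f a}_{a ∈ I}`: receive a tag. -/
def wth (I : Finset Tag) (hI : I.Nonempty) (f : {a // a ∈ I} → SessionType Tag) :
    SessionType Tag := mk (.wth I hI) f

/-- `S ⊗ T`: send a channel of type `S`, continue as `T`. -/
def tensor (S T : SessionType Tag) : SessionType Tag := mk .tensor fun b => cond b T S

/-- `S ⅋ T`: receive a channel of type `S`, continue as `T`. -/
def par (S T : SessionType Tag) : SessionType Tag := mk .par fun b => cond b T S

theorem mk_surj (S : SessionType Tag) : ∃ a f, S = mk a f := by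
  obtain ⟨t, ht⟩ := S
  refine ⟨(PFunctor.M.dest t).1, fun b => ⟨(PFunctor.M.dest t).2 b, ?_⟩, ?_⟩
  · refine Set.Finite.subset ht ?_
    intro s hs
    exact Relation.ReflTransGen.head ⟨b, rfl⟩ hs
  · exact Subtype.ext (PFunctor.M.mk_dest t).symm

/-- `pos(S)`: the root of `S` is an output. -/
def Pos (S : SessionType Tag) : Prop :=
  S = one ∨ (∃ I hI f, S = plus I hI f) ∨ ∃ U V, S = tensor U V

/-- The regular tree unfolded from the coalgebra `step`, where `A` is a finite set of states
closed under `step`. -/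
def unfold {X : Type} (step : X → layer Tag X) (A : Set X) (hA : A.Finite)
    (hc : ∀ x ∈ A, ∀ b, (step x).2 b ∈ A) (x : X) (hx : x ∈ A) : SessionType Tag :=
  ⟨PFunctor.M.corec step x, by
    refine Tree.regular_of_closed (PFunctor.M.corec step '' A) (hA.image _) ⟨x, hx, rfl⟩ ?_
    rintro _ ⟨y, hy, rfl⟩ v ⟨b, hb⟩
    have hb' := hb
    revert b
    rw [PFunctor.M.dest_corec]
    rintro b hb -
    exact ⟨_, hc y hy b, hb⟩⟩

theorem unfold_eq {X : Type} (step : X → layer Tag X) (A : Set X) (hA : A.Finite)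
    (hc : ∀ x ∈ A, ∀ b, (step x).2 b ∈ A) (x : X) (hx : x ∈ A) :
    unfold step A hA hc x hx =
      mk (step x).1 fun b => unfold step A hA hc ((step x).2 b) (hc x hx b) :=
  Subtype.ext (PFunctor.M.corec_def step x)

end SessionType

open SessionType

/-! ## The fair asynchronous labelled transition system -/

/-- Messages: the termination signal `*`, a tag, or a channel of a given type. -/
inductive Message (Tag : Type) : Type
  | close
  | tag (a : Tag)
  | chan (S : SessionType Tag)

/-- Membership in `{*} ∪ Tags`. -/
def Message.IsBasic : Message Tag → Prop
  | .close => True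
  | .tag _ => True
  | .chan _ => False

/-- Labels `!σ` and `?σ`. -/
inductive Label (Tag : Type) : Type
  | out (σ : Message Tag)
  | inp (σ : Message Tag)

/-- Immediate transitions (the axioms). -/
inductive Must : SessionType Tag → Label Tag → SessionType Tag → Prop
  | one : Must one (.out .close) one
  | bot : Must bot (.inp .close) bot
  | plus (I hI f) (a : {a // a ∈ I}) : Must (plus I hI f) (.out (.tag a)) (f a)
  | wth (I hI f) (a : {a // a ∈ I}) : Must (wth I hI f) (.inp (.tag a)) (f a)
  | tensor (S T) : Must (tensor S T) (.out (.chan S)) T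
  | par (S T) : Must (par S T) (.inp (.chan S)) T

/-- `Rule J S α T`: the judgment `S -α→ T` is the conclusion of an axiom, or of a rule for late
inputs or early outputs whose premises are all in `J`. -/
inductive Rule (J : SessionType Tag → Label Tag → SessionType Tag → Prop) :
    SessionType Tag → Label Tag → SessionType Tag → Prop
  | must {S α T} : Must S α T → Rule J S α T
  | mayPlus (I hI f g σ) : (∀ a, J (f a) (.inp σ) (g a)) →
      Rule J (plus I hI f) (.inp σ) (plus I hI g)
  | mayWith (I hI f g σ) : (∀ a, J (f a) (.out σ) (g a)) →
      Rule J (wth I hI f) (.out σ) (wth I hI g)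
  | mayTensor (U S T σ) : J S (.inp σ) T → Rule J (tensor U S) (.inp σ) (tensor U T)
  | mayPar (U S T σ) : J S (.out σ) T → Rule J (par U S) (.out σ) (par U T)

/-- Finite derivability with the rules and the two corules `fairPlus`, `fairWith`, each of which
has a single premise about one branch. -/
inductive FinDeriv : SessionType Tag → Label Tag → SessionType Tag → Prop
  | must {S α T} : Must S α T → FinDeriv S α T
  | mayPlus (I hI f g σ) : (∀ a, FinDeriv (f a) (.inp σ) (g a)) →
      FinDeriv (plus I hI f) (.inp σ) (plus I hI g)
  | mayWith (I hI f g σ) : (∀ a, FinDeriv (f a) (.out σ) (g a)) →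
      FinDeriv (wth I hI f) (.out σ) (wth I hI g)
  | mayTensor (U S T σ) : FinDeriv S (.inp σ) T →
      FinDeriv (tensor U S) (.inp σ) (tensor U T)
  | mayPar (U S T σ) : FinDeriv S (.out σ) T → FinDeriv (par U S) (.out σ) (par U T)
  | fairPlus (I hI f g σ) (k : {a // a ∈ I}) : FinDeriv (f k) (.inp σ) (g k) →
      FinDeriv (plus I hI f) (.inp σ) (plus I hI g)
  | fairWith (I hI f g σ) (k : {a // a ∈ I}) : FinDeriv (f k) (.out σ) (g k) →
      FinDeriv (wth I hI f) (.out σ) (wth I hI g)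

/-- The transition relation `S -α→ T`, by bounded coinduction: there is a possibly infinite
derivation with the rules, all of whose judgments have a finite derivation with rules and
corules. -/
def Trans (S : SessionType Tag) (α : Label Tag) (T : SessionType Tag) : Prop :=
  ∃ J : SessionType Tag → Label Tag → SessionType Tag → Prop, J S α T ∧
    ∀ S' α' T', J S' α' T' → Rule J S' α' T' ∧ FinDeriv S' α' T'

/-! ## Correct asynchronous composition and fair asynchronous subtyping -/

/-- Correct asynchronous composition relations. -/
structure IsCorrectComposition (R : SessionType Tag → SessionType Tag → Prop) : Prop where
  pp : ∀ S T, R S T → Pos S ∨ Pos T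
  oi : ∀ S T, R S T → ∀ σ : Message Tag, σ.IsBasic → ∀ S', Trans S (.out σ) S' →
    ∃ T', Trans T (.inp σ) T' ∧ R S' T'
  io : ∀ S T, R S T → ∀ σ : Message Tag, σ.IsBasic → ∀ T', Trans T (.out σ) T' →
    ∃ S', Trans S (.inp σ) S' ∧ R S' T'
  ois : ∀ S T, R S T → ∀ S₁ S₂, Trans S (.out (.chan S₁)) S₂ →
    ∃ T₁ T₂, Trans T (.inp (.chan T₁)) T₂ ∧ R S₁ T₁ ∧ R S₂ T₂
  ios : ∀ S T, R S T → ∀ T₁ T₂, Trans T (.out (.chan T₁)) T₂ →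
    ∃ S₁ S₂, Trans S (.inp (.chan S₁)) S₂ ∧ R S₁ T₁ ∧ R S₂ T₂

/-- Correct asynchronous composition: the largest correct asynchronous composition relation. -/
def Correct (S T : SessionType Tag) : Prop := ∃ R, IsCorrectComposition R ∧ R S T

/-- Fair asynchronous subtyping `S ≤ T`. -/
def Subtyping (S T : SessionType Tag) : Prop :=
  ∀ R : SessionType Tag, Correct R T → Correct R S

/-! ## Finite presentations of session types and decidability -/

/-- The right-hand side of an equation for a session type, in which a session type is referred to
by the number of its equation. -/
inductive Node (Tag : Type) : Type
  | one
  | bot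
  | plus (bs : List (Tag × ℕ))
  | wth (bs : List (Tag × ℕ))
  | tensor (i j : ℕ)
  | par (i j : ℕ)

/-- Numbers below `n` are the only references; branches are nonempty, with distinct tags. -/
def Node.WellFormed (n : ℕ) : Node Tag → Prop
  | .one => True
  | .bot => True
  | .plus bs => bs ≠ [] ∧ (bs.map Prod.fst).Nodup ∧ ∀ b ∈ bs, b.2 < n
  | .wth bs => bs ≠ [] ∧ (bs.map Prod.fst).Nodup ∧ ∀ b ∈ bs, b.2 < n
  | .tensor i j => i < n ∧ j < n
  | .par i j => i < n ∧ j < n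

/-- `N.Describes τ S`: the right-hand side `N` has the value `S` if number `i` stands for `τ i`. -/
def Node.Describes (τ : ℕ → SessionType Tag) : Node Tag → SessionType Tag → Prop
  | .one, S => S = SessionType.one
  | .bot, S => S = SessionType.bot
  | .plus bs, S => ∃ I hI f, S = SessionType.plus I hI f ∧
      (∀ a, a ∈ I ↔ a ∈ bs.map Prod.fst) ∧ ∀ (a : {a // a ∈ I}) (i : ℕ), (a.1, i) ∈ bs → f a = τ i
  | .wth bs, S => ∃ I hI f, S = SessionType.wth I hI f ∧
      (∀ a, a ∈ I ↔ a ∈ bs.map Prod.fst) ∧ ∀ (a : {a // a ∈ I}) (i : ℕ), (a.1, i) ∈ bs → f a = τ i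
  | .tensor i j, S => S = SessionType.tensor (τ i) (τ j)
  | .par i j, S => S = SessionType.par (τ i) (τ j)

/-- A finite system of equations with the number of its initial equation. -/
abbrev Presentation (Tag : Type) : Type := List (Node Tag) × ℕ

/-- `P` presents the session type `S`: it is well formed and its solution has initial
component `S`. -/
def Presents (P : Presentation Tag) (S : SessionType Tag) : Prop :=
  (P.2 < P.1.length ∧ ∀ N ∈ P.1, N.WellFormed P.1.length) ∧
    ∃ τ : ℕ → SessionType Tag,
      (∀ (i : ℕ) (N : Node Tag), P.1[i]? = some N → N.Describes τ (τ i)) ∧ τ P.2 = S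

/-- A well-formed right-hand side is a layer whose children are numbers. -/
theorem Node.WellFormed.exists_layer {n : ℕ} {N : Node Tag} (h : N.WellFormed n) :
    ∃ z : layer Tag (Fin n), ∀ (τ : ℕ → SessionType Tag) (S : SessionType Tag),
      N.Describes τ S ↔ S = SessionType.mk z.1 fun b => τ (z.2 b) := by
  classical
  have aux : ∀ bs : List (Tag × ℕ), (bs.map Prod.fst).Nodup → (∀ b ∈ bs, b.2 < n) →
      ∃ g : {a // a ∈ (bs.map Prod.fst).toFinset} → Fin n, ∀ a (i : ℕ), (a.1, i) ∈ bs ↔ i = g a := by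
    intro bs hd hb
    have hex : ∀ a : {a // a ∈ (bs.map Prod.fst).toFinset}, ∃ i : Fin n, (a.1, (i : ℕ)) ∈ bs := by
      rintro ⟨a, ha⟩
      obtain ⟨⟨a', i⟩, hi, rfl⟩ := List.mem_map.1 (List.mem_toFinset.1 ha)
      exact ⟨⟨i, hb _ hi⟩, hi⟩
    choose g hg using hex
    refine ⟨g, fun a i => ⟨fun hi => ?_, fun hi => hi ▸ hg a⟩⟩
    exact congrArg Prod.snd (List.inj_on_of_nodup_map hd hi (hg a) rfl)
  have ne : ∀ bs : List (Tag × ℕ), bs ≠ [] → (bs.map Prod.fst).toFinset.Nonempty := by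
    rintro (_ | ⟨b, bs⟩) h
    · exact absurd rfl h
    · exact ⟨b.1, by simp⟩
  cases N with
  | one =>
    refine ⟨⟨.one, Empty.elim⟩, fun τ S => ?_⟩
    have e : SessionType.mk .one (fun b => τ ((Empty.elim b : Fin n) : ℕ)) = SessionType.one :=
      congrArg _ (funext (Empty.rec _))
    exact ⟨fun h => h.trans e.symm, fun h => h.trans e⟩
  | bot =>
    refine ⟨⟨.bot, Empty.elim⟩, fun τ S => ?_⟩
    have e : SessionType.mk .bot (fun b => τ ((Empty.elim b : Fin n) : ℕ)) = SessionType.bot :=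
      congrArg _ (funext (Empty.rec _))
    exact ⟨fun h => h.trans e.symm, fun h => h.trans e⟩
  | plus bs =>
    obtain ⟨g, hg⟩ := aux bs h.2.1 h.2.2
    refine ⟨⟨.plus _ (ne bs h.1), g⟩, fun τ S => ⟨?_, ?_⟩⟩
    · rintro ⟨I, hI, f, rfl, h1, h2⟩
      obtain rfl : I = (bs.map Prod.fst).toFinset := by
        ext a; rw [h1, List.mem_toFinset]
      exact congrArg _ (funext fun a => h2 a _ ((hg a _).2 rfl))
    · rintro rfl
      refine ⟨_, ne bs h.1, _, rfl, fun a => List.mem_toFinset, fun a i hi => ?_⟩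
      rw [(hg a i).1 hi]
  | wth bs =>
    obtain ⟨g, hg⟩ := aux bs h.2.1 h.2.2
    refine ⟨⟨.wth _ (ne bs h.1), g⟩, fun τ S => ⟨?_, ?_⟩⟩
    · rintro ⟨I, hI, f, rfl, h1, h2⟩
      obtain rfl : I = (bs.map Prod.fst).toFinset := by
        ext a; rw [h1, List.mem_toFinset]
      exact congrArg _ (funext fun a => h2 a _ ((hg a _).2 rfl))
    · rintro rfl
      refine ⟨_, ne bs h.1, _, rfl, fun a => List.mem_toFinset, fun a i hi => ?_⟩
      rw [(hg a i).1 hi]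
  | tensor i j =>
    refine ⟨⟨.tensor, fun b => cond b ⟨j, h.2⟩ ⟨i, h.1⟩⟩, fun τ S => ?_⟩
    have e : SessionType.mk .tensor (fun b => τ ((cond b ⟨j, h.2⟩ ⟨i, h.1⟩ : Fin n) : ℕ)) =
        SessionType.tensor (τ i) (τ j) := congrArg _ (funext (by rintro (_ | _) <;> rfl))
    exact ⟨fun h => h.trans e.symm, fun h => h.trans e⟩
  | par i j =>
    refine ⟨⟨.par, fun b => cond b ⟨j, h.2⟩ ⟨i, h.1⟩⟩, fun τ S => ?_⟩
    have e : SessionType.mk .par (fun b => τ ((cond b ⟨j, h.2⟩ ⟨i, h.1⟩ : Fin n) : ℕ)) =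
        SessionType.par (τ i) (τ j) := congrArg _ (funext (by rintro (_ | _) <;> rfl))
    exact ⟨fun h => h.trans e.symm, fun h => h.trans e⟩

/-- Every well-formed presentation presents exactly one session type. -/
theorem existsUnique_presents (P : Presentation Tag) (h0 : P.2 < P.1.length)
    (h : ∀ N ∈ P.1, N.WellFormed P.1.length) : ∃! S, Presents P S := by
  have hz : ∀ i : Fin P.1.length, ∃ z : layer Tag (Fin P.1.length),
      ∀ (τ : ℕ → SessionType Tag) (S : SessionType Tag),
        P.1[i].Describes τ S ↔ S = SessionType.mk z.1 fun b => τ (z.2 b) :=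
    fun i => (h _ (List.getElem_mem i.2)).exists_layer
  choose z hz using hz
  have hA := Set.finite_univ (α := Fin P.1.length)
  let u : Fin P.1.length → SessionType Tag := fun i =>
    unfold z Set.univ hA (fun _ _ _ => Set.mem_univ _) i (Set.mem_univ _)
  have hu : ∀ i, u i = SessionType.mk (z i).1 fun b => u ((z i).2 b) := fun i =>
    unfold_eq z Set.univ hA (fun _ _ _ => Set.mem_univ _) i (Set.mem_univ _)
  refine ⟨u ⟨P.2, h0⟩, ⟨⟨h0, h⟩, fun i => if hi : i < P.1.length then u ⟨i, hi⟩ else .one, ?_, ?_⟩, ?_⟩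
  · intro i N hN
    obtain ⟨hi, rfl⟩ := List.getElem?_eq_some_iff.1 hN
    refine (hz ⟨i, hi⟩ _ _).2 ?_
    simp only [dif_pos hi, Fin.is_lt, dite_true, Fin.eta]
    exact hu _
  · simp only [dif_pos h0]
  · rintro _ ⟨_, τ, hτ, rfl⟩
    have key : ∀ i : Fin P.1.length, τ i = SessionType.mk (z i).1 fun b => τ ((z i).2 b) :=
      fun i => (hz i _ _).1 (hτ i _ (List.getElem?_eq_getElem i.2))
    have h2 := PFunctor.M.corec_unique z (fun i : Fin P.1.length => (τ i).1) fun i =>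
      congrArg (fun S : SessionType Tag => PFunctor.M.dest S.1) (key i)
    exact Subtype.ext (congrFun h2 ⟨P.2, h0⟩)

/-- Every session type has a presentation. -/
theorem exists_presents (S : SessionType Tag) : ∃ P, Presents P S := by
  classical
  let A : Set (SessionType Tag) := {T | Relation.ReflTransGen Tree.IsChild S.1 T.1}
  have hA : A.Finite := Set.Finite.preimage Subtype.val_injective.injOn S.2
  have hS : S ∈ A := Relation.ReflTransGen.refl
  have hc : ∀ a f, SessionType.mk a f ∈ A → ∀ b, f b ∈ A := fun a f h b =>
    Relation.ReflTransGen.tail h ⟨b, rfl⟩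
  let l := hA.toFinset.toList
  have hl : ∀ T, T ∈ l ↔ T ∈ A := fun T => by simp [l]
  let τ : ℕ → SessionType Tag := fun i => l.getD i .one
  let ix : SessionType Tag → ℕ := fun T => l.idxOf T
  have hix : ∀ T ∈ A, ix T < l.length := fun T hT => List.idxOf_lt_length_of_mem ((hl T).2 hT)
  have hτ : ∀ T ∈ A, τ (ix T) = T := fun T hT => by
    simp only [τ, ix, List.getD_eq_getElem _ _ (hix T hT), List.getElem_idxOf]
  have hnd : ∀ (I : Finset Tag) (f : {a // a ∈ I} → ℕ),
      ((I.attach.toList.map fun a => (a.1, f a)).map Prod.fst).Nodup := fun I f => by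
    rw [List.map_map]
    exact (Finset.nodup_toList _).map Subtype.val_injective
  have hmem : ∀ (I : Finset Tag) (f : {a // a ∈ I} → ℕ) a,
      a ∈ I ↔ a ∈ (I.attach.toList.map fun a => (a.1, f a)).map Prod.fst := fun I f a => by simp
  have hN : ∀ T ∈ A, ∃ N : Node Tag, N.WellFormed l.length ∧ N.Describes τ T := by
    intro T hT
    obtain ⟨a, f, rfl⟩ := mk_surj T
    have hf := hc _ _ hT
    cases a with
    | one => exact ⟨.one, trivial, congrArg _ (funext (Empty.rec _))⟩
    | bot => exact ⟨.bot, trivial, congrArg _ (funext (Empty.rec _))⟩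
    | plus I hI =>
      refine ⟨.plus (I.attach.toList.map fun a => (a.1, ix (f a))),
        ⟨?_, hnd I (fun a => ix (f a)), ?_⟩, I, hI, f, rfl,
        hmem I (fun a => ix (f a)), ?_⟩
      · obtain ⟨a, ha⟩ := hI
        exact List.ne_nil_of_mem (List.mem_map.2
          ⟨⟨a, ha⟩, Finset.mem_toList.2 (Finset.mem_attach _ _), rfl⟩)
      · intro b hb
        obtain ⟨a, -, rfl⟩ := List.mem_map.1 hb
        exact hix _ (hf a)
      · intro a i hi
        obtain ⟨a', -, h⟩ := List.mem_map.1 hi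
        obtain rfl : a' = a := Subtype.ext (congrArg Prod.fst h)
        obtain rfl : ix (f a') = i := congrArg Prod.snd h
        exact (hτ _ (hf a')).symm
    | wth I hI =>
      refine ⟨.wth (I.attach.toList.map fun a => (a.1, ix (f a))),
        ⟨?_, hnd I (fun a => ix (f a)), ?_⟩, I, hI, f, rfl,
        hmem I (fun a => ix (f a)), ?_⟩
      · obtain ⟨a, ha⟩ := hI
        exact List.ne_nil_of_mem (List.mem_map.2
          ⟨⟨a, ha⟩, Finset.mem_toList.2 (Finset.mem_attach _ _), rfl⟩)
      · intro b hb
        obtain ⟨a, -, rfl⟩ := List.mem_map.1 hb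
        exact hix _ (hf a)
      · intro a i hi
        obtain ⟨a', -, h⟩ := List.mem_map.1 hi
        obtain rfl : a' = a := Subtype.ext (congrArg Prod.fst h)
        obtain rfl : ix (f a') = i := congrArg Prod.snd h
        exact (hτ _ (hf a')).symm
    | tensor =>
      refine ⟨.tensor (ix (f false)) (ix (f true)), ⟨hix _ (hf _), hix _ (hf _)⟩, ?_⟩
      have e : SessionType.mk .tensor f = SessionType.tensor (f false) (f true) :=
        congrArg _ (funext (by rintro (_ | _) <;> rfl))
      exact e.trans (congrArg₂ _ (hτ _ (hf false)).symm (hτ _ (hf true)).symm)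
    | par =>
      refine ⟨.par (ix (f false)) (ix (f true)), ⟨hix _ (hf _), hix _ (hf _)⟩, ?_⟩
      have e : SessionType.mk .par f = SessionType.par (f false) (f true) :=
        congrArg _ (funext (by rintro (_ | _) <;> rfl))
      exact e.trans (congrArg₂ _ (hτ _ (hf false)).symm (hτ _ (hf true)).symm)
  have : Nonempty (Node Tag) := ⟨.one⟩
  choose! N hN using hN
  refine ⟨(l.map N, ix S), ⟨by simpa using hix S hS, ?_⟩, τ, ?_, hτ S hS⟩
  · intro n hn
    obtain ⟨T, hT, rfl⟩ := List.mem_map.1 hn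
    simpa using (hN T ((hl T).1 hT)).1
  · intro i n hn
    obtain ⟨T, hT, rfl⟩ := Option.map_eq_some_iff.1 (List.getElem?_map ▸ hn)
    obtain ⟨hi, rfl⟩ := List.getElem?_eq_some_iff.1 hT
    simpa only [τ, List.getD_eq_getElem _ _ hi] using (hN _ ((hl _).1 (List.getElem_mem hi))).2

/-- Nodes as elements of a sum type, for the coding by natural numbers. -/
def Node.equiv (Tag : Type) : Node Tag ≃
    Bool × (Unit ⊕ List (Tag × ℕ) ⊕ (ℕ × ℕ)) where
  toFun
    | .one => (true, .inl ())
    | .bot => (false, .inl ())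
    | .plus bs => (true, .inr (.inl bs))
    | .wth bs => (false, .inr (.inl bs))
    | .tensor i j => (true, .inr (.inr (i, j)))
    | .par i j => (false, .inr (.inr (i, j)))
  invFun
    | (true, .inl ()) => .one
    | (false, .inl ()) => .bot
    | (true, .inr (.inl bs)) => .plus bs
    | (false, .inr (.inl bs)) => .wth bs
    | (true, .inr (.inr (i, j))) => .tensor i j
    | (false, .inr (.inr (i, j))) => .par i j
  left_inv N := by cases N <;> rfl
  right_inv := by rintro ⟨_ | _, _ | _ | _⟩ <;> rfl

instance Node.primcodable [Primcodable Tag] : Primcodable (Node Tag) :=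
  Primcodable.ofEquiv _ (Node.equiv Tag)

/-- A relation on session types is decidable if some computable predicate answers correctly on all
pairs of finite presentations of session types (no matter what it answers on other inputs). -/
def DecidableOnPresentations [Primcodable Tag]
    (r : SessionType Tag → SessionType Tag → Prop) : Prop :=
  ∃ p : Presentation Tag × Presentation Tag → Prop, ComputablePred p ∧
    ∀ P Q S T, Presents P S → Presents Q T → (p (P, Q) ↔ r S T)

/-! ## Queue machines and their encoding -/

/-- Queue machines, whose queue symbols are tags. -/
structure QueueMachine (Tag : Type) where
  State : Type
  finite_state : Finite State
  queueAlphabet : Finset Tag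
  inputAlphabet : Finset Tag
  input_subset : inputAlphabet ⊆ queueAlphabet
  dollar : Tag
  dollar_mem : dollar ∈ queueAlphabet
  dollar_not_input : dollar ∉ inputAlphabet
  start : State
  δ : State → {a // a ∈ queueAlphabet} → State × List {a // a ∈ queueAlphabet}

namespace QueueMachine

/-- Queue symbols. -/
abbrev Sym (M : QueueMachine Tag) : Type := {a // a ∈ M.queueAlphabet}

/-- Configurations: current state and queue. -/
abbrev Config (M : QueueMachine Tag) : Type := M.State × List M.Sym

/-- `(p, Aα) → (q, αγ)` whenever `δ(p, A) = (q, γ)`. -/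
def Step (M : QueueMachine Tag) (c d : M.Config) : Prop :=
  ∃ (p : M.State) (A : M.Sym) (α : List M.Sym),
    c = (p, A :: α) ∧ d = ((M.δ p A).1, α ++ (M.δ p A).2)

/-- The initial queue `x$`. -/
def initialQueue (M : QueueMachine Tag) (x : List {a // a ∈ M.inputAlphabet}) : List M.Sym :=
  x.map (fun a => ⟨a.1, M.input_subset a.2⟩) ++ [⟨M.dollar, M.dollar_mem⟩]

/-- `M` accepts `x` if it empties the queue on input `x`. -/
def Accepts (M : QueueMachine Tag) (x : List {a // a ∈ M.inputAlphabet}) : Prop :=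
  ∃ q, Relation.ReflTransGen M.Step (M.start, M.initialQueue x) (q, [])

theorem alphabet_nonempty (M : QueueMachine Tag) : M.queueAlphabet.Nonempty :=
  ⟨_, M.dollar_mem⟩

end QueueMachine

/-- `⊕{a : S}`. -/
def SessionType.send (a : Tag) (S : SessionType Tag) : SessionType Tag :=
  plus {a} (Finset.singleton_nonempty a) fun _ => S

namespace QueueMachine

variable (M : QueueMachine Tag)

/-- `⊕{X₁ : ⊕{X₂ : ⋯ ⊕{Xₙ : S}}}`. -/
def sendAll (w : List M.Sym) (S : SessionType Tag) : SessionType Tag :=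
  w.foldr (fun a T => send a.1 T) S

/-- Coalgebra for `Q^M`: the state `none` is `Q^M` and `some A` is `⊕{A : Q^M}`. -/
def queueStep : Option M.Sym → layer Tag (Option M.Sym)
  | none => ⟨.wth M.queueAlphabet M.alphabet_nonempty, fun A => some A⟩
  | some A => ⟨.plus {A.1} (Finset.singleton_nonempty _), fun _ => none⟩

/-- The session type `Q^M = &{A : ⊕{A : Q^M}}_{A ∈ Γ}`. -/
def queueLoop : SessionType Tag :=
  unfold M.queueStep Set.univ Set.finite_univ (fun _ _ _ => Set.mem_univ _) none (Set.mem_univ _)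

theorem queueLoop_eq : M.queueLoop =
    wth M.queueAlphabet M.alphabet_nonempty fun A => send A.1 M.queueLoop := by
  refine (unfold_eq _ _ _ _ none _).trans
    (congrArg (wth M.queueAlphabet M.alphabet_nonempty) (funext fun A => ?_))
  exact unfold_eq _ _ _ _ (some A) _

/-- The session type `Q^M_w = ⊕{X₁ : ⋯ ⊕{Xₙ : Q^M}}` for the queue `w = X₁⋯Xₙ`. -/
def queueType (w : List M.Sym) : SessionType Tag := M.sendAll w M.queueLoop

/-- Coalgebra for `S^M_q`: the state `(q, w)` is the sequence of outputs `w` followed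
by `S^M_q`. -/
def controlStep : M.State × List M.Sym → layer Tag (M.State × List M.Sym)
  | (q, []) => ⟨.wth M.queueAlphabet M.alphabet_nonempty, fun A => M.δ q A⟩
  | (q, B :: w) => ⟨.plus {B.1} (Finset.singleton_nonempty _), fun _ => (q, w)⟩

/-- The states that can occur: the outputs still to be made are a suffix of some `γ`
with `δ(p, A) = (q', γ)`. -/
def controlStates : Set (M.State × List M.Sym) :=
  {c | c.2 = [] ∨ ∃ p A, c.2 <:+ (M.δ p A).2}

theorem nil_mem_controlStates (q : M.State) : (q, []) ∈ M.controlStates := Or.inl rfl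

theorem controlStates_finite : M.controlStates.Finite := by
  have := M.finite_state
  have h : ({w : List M.Sym | w = [] ∨ ∃ p A, w <:+ (M.δ p A).2}).Finite := by
    have h2 : (⋃ p, ⋃ A, {w : List M.Sym | w ∈ (M.δ p A).2.tails}).Finite :=
      Set.finite_iUnion fun p => Set.finite_iUnion fun A => List.finite_toSet _
    refine (h2.insert []).subset ?_
    rintro w (rfl | ⟨p, A, hw⟩)
    · exact Set.mem_insert _ _
    · exact Or.inr (Set.mem_iUnion.2 ⟨p, Set.mem_iUnion.2 ⟨A, (List.mem_tails _ _).2 hw⟩⟩)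
  exact ((Set.finite_univ (α := M.State)).prod h).subset fun c hc => ⟨Set.mem_univ _, hc⟩

theorem controlStates_closed :
    ∀ c ∈ M.controlStates, ∀ b, (M.controlStep c).2 b ∈ M.controlStates := by
  rintro ⟨q, _ | ⟨B, w⟩⟩ hc b
  · exact Or.inr ⟨q, b, List.suffix_refl _⟩
  · rcases hc with hc | ⟨p, A, hc⟩
    · cases hc
    · exact Or.inr ⟨p, A, (List.suffix_cons B w).trans hc⟩

/-- The session type `S^M_q = &{A : ⊕{B₁ : ⋯ ⊕{Bₙ : S^M_q'}}}_{A ∈ Γ}`, where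
`δ(q, A) = (q', B₁⋯Bₙ)`. -/
def controlType (q : M.State) : SessionType Tag :=
  unfold M.controlStep M.controlStates M.controlStates_finite M.controlStates_closed (q, [])
    (M.nil_mem_controlStates q)

theorem controlType_eq (q : M.State) : M.controlType q =
    wth M.queueAlphabet M.alphabet_nonempty fun A =>
      M.sendAll (M.δ q A).2 (M.controlType (M.δ q A).1) := by
  have key : ∀ (w : List M.Sym) (p : M.State) (h : (p, w) ∈ M.controlStates),
      unfold M.controlStep M.controlStates M.controlStates_finite M.controlStates_closed (p, w) h =
        M.sendAll w (M.controlType p) := by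
    intro w
    induction w with
    | nil => intro p h; rfl
    | cons B w ih =>
      intro p h
      exact (unfold_eq _ _ _ _ _ h).trans
        (congrArg (send B.1) (ih p (M.controlStates_closed _ h ⟨B.1, Finset.mem_singleton_self _⟩)))
  exact (unfold_eq _ _ _ _ (q, []) (M.nil_mem_controlStates q)).trans
    (congrArg (wth M.queueAlphabet M.alphabet_nonempty)
      (funext fun A => key _ _ (M.controlStates_closed _ (M.nil_mem_controlStates q) A)))

end QueueMachine

end AsyncSession

/-!
Correct composition is analysed through a labelled transition system in which outputs may be made
early and inputs may be served late.

**The encoding of queue machines.** `Q^M_w` behaves as the queue `w` and `S^M_q` as the finite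
control. If the machine empties its queue, the exchanges along its run are forced and lead to two
types that both wait for an input, so the composition is not correct (`Halts.not_correct`). If the
queue never becomes empty, an explicit correct composition relation is given. Early outputs are
the difficulty: the control type may emit symbols before it has read the symbols that trigger
them. Since inputs commute with early outputs (`IsTagged.diamond`), it is enough to follow the run
of the machine and to record which word `v` of outputs was made ahead of time. With at least two
queue symbols `Q^M` makes no early outputs, and the queue side is always `Q^M_{wv}`. With one queue
symbol `Q^M` can make early outputs as well, but then only lengths matter, and the queue side is a
queue of possibly negative length. Together this is `QueueMachine.correct_iff_not_halts`.

**Undecidability of correct composition.** A program that halts on `2 ^ n` for an undecidable set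
of numbers `n` compiles to a machine with finitely many stacks (`PartrecToTM2`). A queue machine
simulates such a machine by keeping all stacks in its queue and rotating the queue once per
instruction (`respects_simStep`); when the stack machine halts, the queue is drained. The queue
machine is fixed, and only the length of one block of equal symbols in its initial queue depends
on `n`. Hence the two presentations are computable from `n`: one is constant, and the other one
arises from a constant by prefixing outputs.

**Undecidability of subtyping.** Exchanging inputs and outputs maps transitions to transitions, so
each type is correctly composed with its dual, and correct composition is closed under cut:
if `R` is correctly composed with `T`, and `T.dual` with `S`, then `R` is with `S`. Therefore `S`
and `T` are correctly composed if and only if `T` is a subtype of `S.dual`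
(`correct_iff_subtyping`), and dual presentations are computable.
-/

namespace AsyncSession

variable {Tag : Type}

open SessionType

/-! ### Roots of session types and inversion of transitions -/

namespace SessionType

/-- The root of a session type together with the children. -/
def root (S : SessionType Tag) : layer Tag (SessionType Tag) :=
  ⟨(PFunctor.M.dest S.1).1, fun b => ⟨(PFunctor.M.dest S.1).2 b, S.2.subset fun _ hs =>
    Relation.ReflTransGen.head ⟨b, rfl⟩ hs⟩⟩

@[simp] theorem root_mk (a : Shape Tag) (f : a.Child → SessionType Tag) : (mk a f).root = ⟨a, f⟩ :=
  rfl

theorem mk_inj {a : Shape Tag} {f g : a.Child → SessionType Tag} (h : mk a f = mk a g) : f = g := by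
  have := congrArg root h
  simp only [root_mk] at this
  exact eq_of_heq (Sigma.mk.inj this).2

theorem shape_eq_of_mk_eq {a b : Shape Tag} {f : a.Child → SessionType Tag}
    {g : b.Child → SessionType Tag} (h : mk a f = mk b g) : a = b :=
  congrArg (fun S => S.root.1) h

theorem wth_inj {I J : Finset Tag} {hI hJ f g} (h : wth I hI f = wth J hJ g) :
    I = J ∧ f ≍ g := by
  obtain rfl : I = J := by simpa using shape_eq_of_mk_eq h
  exact ⟨rfl, heq_of_eq (mk_inj h)⟩

theorem plus_inj {I J : Finset Tag} {hI hJ f g} (h : plus I hI f = plus J hJ g) :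
    I = J ∧ f ≍ g := by
  obtain rfl : I = J := by simpa using shape_eq_of_mk_eq h
  exact ⟨rfl, heq_of_eq (mk_inj h)⟩

theorem pos_mk (a : Shape Tag) (f : a.Child → SessionType Tag) :
    Pos (mk a f) ↔ match a with
      | .one | .plus _ _ | .tensor => True
      | _ => False := by
  constructor
  · rintro (h | ⟨I, hI, g, h⟩ | ⟨U, V, h⟩) <;> cases shape_eq_of_mk_eq h <;> trivial
  · cases a with
    | one => exact fun _ => .inl (congrArg _ (funext (Empty.rec _)))
    | plus I hI => exact fun _ => .inr (.inl ⟨I, hI, f, rfl⟩)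
    | tensor =>
      exact fun _ => .inr (.inr ⟨f false, f true, congrArg _ (funext (by rintro (_ | _) <;> rfl))⟩)
    | _ => exact False.elim

theorem pos_plus (I : Finset Tag) (hI f) : Pos (plus I hI f) := .inr (.inl ⟨I, hI, f, rfl⟩)

theorem not_pos_wth (I : Finset Tag) (hI f) : ¬ Pos (wth I hI f) := by
  rw [wth, pos_mk]; exact id

end SessionType

theorem Rule.mono {J K : SessionType Tag → Label Tag → SessionType Tag → Prop}
    (h : ∀ S α T, J S α T → K S α T) {S α T} (hr : Rule J S α T) : Rule K S α T := by
  cases hr with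
  | must h' => exact .must h'
  | mayPlus I hI f g σ h' => exact .mayPlus I hI f g σ fun a => h _ _ _ (h' a)
  | mayWith I hI f g σ h' => exact .mayWith I hI f g σ fun a => h _ _ _ (h' a)
  | mayTensor U S T σ h' => exact .mayTensor U S T σ (h _ _ _ h')
  | mayPar U S T σ h' => exact .mayPar U S T σ (h _ _ _ h')

theorem Trans.finDeriv {S : SessionType Tag} {α T} (h : Trans S α T) : FinDeriv S α T := by
  obtain ⟨J, hJ, h⟩ := h
  exact (h _ _ _ hJ).2

theorem Rule.finDeriv {S : SessionType Tag} {α T} (h : Rule FinDeriv S α T) : FinDeriv S α T := by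
  cases h with
  | must h => exact .must h
  | mayPlus I hI f g σ h => exact .mayPlus I hI f g σ h
  | mayWith I hI f g σ h => exact .mayWith I hI f g σ h
  | mayTensor U S T σ h => exact .mayTensor U S T σ h
  | mayPar U S T σ h => exact .mayPar U S T σ h

/-- The transition relation is a fixed point of the rules: premises of axioms and rules are
again transitions, and conclusions of rules from transitions are transitions. -/
theorem trans_iff {S : SessionType Tag} {α T} : Trans S α T ↔ Rule Trans S α T := by
  constructor
  · rintro ⟨J, hJ, h⟩
    exact (h _ _ _ hJ).1.mono fun _ _ _ hJ' => ⟨J, hJ', h⟩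
  · intro h
    refine ⟨Rule Trans, h, fun S' α' T' h' =>
      ⟨h'.mono ?_, (h'.mono fun _ _ _ => Trans.finDeriv).finDeriv⟩⟩
    rintro S α T ⟨J, hJ, h⟩
    exact (h _ _ _ hJ).1.mono fun _ _ _ hJ' => ⟨J, hJ', h⟩

theorem Trans.must {S : SessionType Tag} {α T} (h : Must S α T) : Trans S α T :=
  trans_iff.2 (.must h)

theorem rule_plus_out {J : SessionType Tag → Label Tag → SessionType Tag → Prop} {I hI f σ T} :
    Rule J (plus I hI f) (.out σ) T ↔ ∃ a : {a // a ∈ I}, σ = .tag a.1 ∧ T = f a := by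
  constructor
  · generalize hS : plus I hI f = S
    generalize hα : Label.out σ = α
    rintro (h | h | ⟨K, hK, g, g', _, h⟩ | h | ⟨U, V, W, _, h⟩)
    · cases h with
      | plus K hK g a =>
        obtain ⟨rfl, ⟨⟩⟩ := plus_inj hS
        exact ⟨a, by simpa using hα, rfl⟩
      | one => cases shape_eq_of_mk_eq hS
      | tensor => cases shape_eq_of_mk_eq hS
      | _ => cases hα
    · cases hα
    · cases shape_eq_of_mk_eq hS
    · cases hα
    · cases shape_eq_of_mk_eq hS
  · rintro ⟨a, rfl, rfl⟩
    exact .must (.plus _ _ _ _)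

theorem rule_wth_inp {J : SessionType Tag → Label Tag → SessionType Tag → Prop} {I hI f σ T} :
    Rule J (wth I hI f) (.inp σ) T ↔ ∃ a : {a // a ∈ I}, σ = .tag a.1 ∧ T = f a := by
  constructor
  · generalize hS : wth I hI f = S
    generalize hα : Label.inp σ = α
    rintro (h | ⟨K, hK, g, g', _, h⟩ | h | ⟨U, V, W, _, h⟩ | h)
    · cases h with
      | wth K hK g a =>
        obtain ⟨rfl, ⟨⟩⟩ := wth_inj hS
        exact ⟨a, by simpa using hα, rfl⟩
      | bot => cases shape_eq_of_mk_eq hS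
      | par => cases shape_eq_of_mk_eq hS
      | _ => cases hα
    · cases shape_eq_of_mk_eq hS
    · cases hα
    · cases shape_eq_of_mk_eq hS
    · cases hα
  · rintro ⟨a, rfl, rfl⟩
    exact .must (.wth _ _ _ _)

theorem rule_plus_inp {J : SessionType Tag → Label Tag → SessionType Tag → Prop} {I hI f σ T} :
    Rule J (plus I hI f) (.inp σ) T ↔ ∃ g, T = plus I hI g ∧ ∀ a, J (f a) (.inp σ) (g a) := by
  constructor
  · generalize hS : plus I hI f = S
    generalize hα : Label.inp σ = α
    rintro (h | ⟨K, hK, g, g', _, h⟩ | h | ⟨U, V, W, _, h⟩ | h)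
    · cases h with
      | wth => cases shape_eq_of_mk_eq hS
      | bot => cases shape_eq_of_mk_eq hS
      | par => cases shape_eq_of_mk_eq hS
      | _ => cases hα
    · obtain ⟨rfl, ⟨⟩⟩ := plus_inj hS
      cases hα
      exact ⟨_, rfl, h⟩
    · cases hα
    · cases shape_eq_of_mk_eq hS
    · cases hα
  · rintro ⟨g, rfl, h⟩
    exact .mayPlus _ _ _ _ _ h

theorem rule_wth_out {J : SessionType Tag → Label Tag → SessionType Tag → Prop} {I hI f σ T} :
    Rule J (wth I hI f) (.out σ) T ↔ ∃ g, T = wth I hI g ∧ ∀ a, J (f a) (.out σ) (g a) := by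
  constructor
  · generalize hS : wth I hI f = S
    generalize hα : Label.out σ = α
    rintro (h | h | ⟨K, hK, g, g', _, h⟩ | h | ⟨U, V, W, _, h⟩)
    · cases h with
      | plus => cases shape_eq_of_mk_eq hS
      | one => cases shape_eq_of_mk_eq hS
      | tensor => cases shape_eq_of_mk_eq hS
      | _ => cases hα
    · cases hα
    · obtain ⟨rfl, ⟨⟩⟩ := wth_inj hS
      cases hα
      exact ⟨_, rfl, h⟩
    · cases hα
    · cases shape_eq_of_mk_eq hS
  · rintro ⟨g, rfl, h⟩
    exact .mayWith _ _ _ _ _ h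

theorem trans_plus_out {I : Finset Tag} {hI f σ T} :
    Trans (plus I hI f) (.out σ) T ↔ ∃ a : {a // a ∈ I}, σ = .tag a.1 ∧ T = f a :=
  trans_iff.trans rule_plus_out

theorem trans_wth_inp {I : Finset Tag} {hI f σ T} :
    Trans (wth I hI f) (.inp σ) T ↔ ∃ a : {a // a ∈ I}, σ = .tag a.1 ∧ T = f a :=
  trans_iff.trans rule_wth_inp

theorem trans_plus_inp {I : Finset Tag} {hI f σ T} :
    Trans (plus I hI f) (.inp σ) T ↔ ∃ g, T = plus I hI g ∧ ∀ a, Trans (f a) (.inp σ) (g a) :=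
  trans_iff.trans rule_plus_inp

theorem trans_wth_out {I : Finset Tag} {hI f σ T} :
    Trans (wth I hI f) (.out σ) T ↔ ∃ g, T = wth I hI g ∧ ∀ a, Trans (f a) (.out σ) (g a) :=
  trans_iff.trans rule_wth_out

theorem trans_send_out {a : Tag} {S T : SessionType Tag} {σ} :
    Trans (send a S) (.out σ) T ↔ σ = .tag a ∧ T = S := by
  rw [send, trans_plus_out]
  constructor
  · rintro ⟨⟨b, hb⟩, rfl, rfl⟩
    exact ⟨congrArg _ (Finset.mem_singleton.1 hb), rfl⟩
  · rintro ⟨rfl, rfl⟩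
    exact ⟨⟨a, Finset.mem_singleton_self a⟩, rfl, rfl⟩

theorem trans_send_inp {a : Tag} {S T : SessionType Tag} {σ} :
    Trans (send a S) (.inp σ) T ↔ ∃ S', T = send a S' ∧ Trans S (.inp σ) S' := by
  rw [send, trans_plus_inp]
  constructor
  · rintro ⟨g, rfl, h⟩
    refine ⟨g ⟨a, Finset.mem_singleton_self a⟩, ?_, h _⟩
    refine congrArg (plus _ _) (funext ?_)
    rintro ⟨b, hb⟩
    obtain rfl := Finset.mem_singleton.1 hb
    rfl
  · rintro ⟨S', rfl, h⟩
    exact ⟨_, rfl, fun _ => h⟩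

/-! ### Duality -/

/-- The dual root: outputs and inputs are exchanged. -/
def Shape.dual : Shape Tag → Shape Tag
  | .one => .bot
  | .bot => .one
  | .plus I hI => .wth I hI
  | .wth I hI => .plus I hI
  | .tensor => .par
  | .par => .tensor

/-- A root and its dual have the same children. -/
def Shape.ofDualChild : (a : Shape Tag) → a.dual.Child → a.Child
  | .one, b => b
  | .bot, b => b
  | .plus _ _, b => b
  | .wth _ _, b => b
  | .tensor, b => b
  | .par, b => b

/-- Dualisation of one layer. -/
def dualLayer {X : Type} (x : layer Tag X) : layer Tag X :=
  ⟨x.1.dual, fun b => x.2 (x.1.ofDualChild b)⟩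

/-- The dual of a session type, with outputs and inputs exchanged everywhere. -/
def SessionType.dual (S : SessionType Tag) : SessionType Tag :=
  unfold (fun t : Tree Tag => dualLayer (PFunctor.M.dest t))
    {t | Relation.ReflTransGen Tree.IsChild S.1 t} S.2
    (fun _ hx _ => Relation.ReflTransGen.tail hx ⟨_, rfl⟩) S.1 Relation.ReflTransGen.refl

namespace SessionType

theorem dual_mk (a : Shape Tag) (f : a.Child → SessionType Tag) :
    (mk a f).dual = mk a.dual fun b => (f (a.ofDualChild b)).dual :=
  Subtype.ext (PFunctor.M.corec_def _ _)

theorem dual_dual (S : SessionType Tag) : S.dual.dual = S := by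
  have h : (fun S : SessionType Tag => S.dual.dual.1) = fun S => S.1 := by
    rw [PFunctor.M.corec_unique root (fun S : SessionType Tag => S.dual.dual.1),
      PFunctor.M.corec_unique root (fun S : SessionType Tag => S.1)]
    · exact fun _ => rfl
    · intro S
      obtain ⟨a, f, rfl⟩ := mk_surj S
      rw [dual_mk, dual_mk]
      cases a <;> rfl
  exact Subtype.ext (congrFun h S)

@[simp] theorem dual_one : (one : SessionType Tag).dual = bot :=
  (dual_mk _ _).trans (congrArg _ (funext (Empty.rec _)))

@[simp] theorem dual_bot : (bot : SessionType Tag).dual = one :=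
  (dual_mk _ _).trans (congrArg _ (funext (Empty.rec _)))

@[simp] theorem dual_plus (I : Finset Tag) (hI f) :
    (plus I hI f).dual = wth I hI fun a => (f a).dual := dual_mk _ _

@[simp] theorem dual_wth (I : Finset Tag) (hI f) :
    (wth I hI f).dual = plus I hI fun a => (f a).dual := dual_mk _ _

@[simp] theorem dual_tensor (S T : SessionType Tag) : (tensor S T).dual = par S.dual T.dual :=
  (dual_mk _ _).trans (congrArg _ (funext (by rintro (_ | _) <;> rfl)))

@[simp] theorem dual_par (S T : SessionType Tag) : (par S T).dual = tensor S.dual T.dual :=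
  (dual_mk _ _).trans (congrArg _ (funext (by rintro (_ | _) <;> rfl)))

theorem pos_dual (S : SessionType Tag) : Pos S.dual ↔ ¬ Pos S := by
  obtain ⟨a, f, rfl⟩ := mk_surj S
  rw [dual_mk, pos_mk, pos_mk]
  cases a <;> simp [Shape.dual]

end SessionType

/-- The dual message: the type of a channel is dualised. -/
def Message.dual : Message Tag → Message Tag
  | .close => .close
  | .tag a => .tag a
  | .chan S => .chan S.dual

/-- The dual label. -/
def Label.dual : Label Tag → Label Tag
  | .out σ => .inp σ.dual
  | .inp σ => .out σ.dual

theorem Message.IsBasic.dual_eq {σ : Message Tag} (h : σ.IsBasic) : σ.dual = σ := by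
  cases σ
  · rfl
  · rfl
  · exact h.elim

theorem Must.dual {S : SessionType Tag} {α T} (h : Must S α T) : Must S.dual α.dual T.dual := by
  cases h with
  | one => rw [dual_one]; exact .bot
  | bot => rw [dual_bot]; exact .one
  | plus I hI f a => rw [dual_plus]; exact Must.wth I hI (fun a => (f a).dual) a
  | wth I hI f a => rw [dual_wth]; exact Must.plus I hI (fun a => (f a).dual) a
  | tensor S T => rw [dual_tensor]; exact .par _ _
  | par S T => rw [dual_par]; exact .tensor _ _

theorem Rule.dual {J K : SessionType Tag → Label Tag → SessionType Tag → Prop}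
    (hJ : ∀ S α T, J S α T → K S.dual α.dual T.dual) {S α T} (h : Rule J S α T) :
    Rule K S.dual α.dual T.dual := by
  cases h with
  | must h => exact .must h.dual
  | mayPlus I hI f g σ h =>
    simp only [dual_plus]; exact .mayWith I hI _ _ _ fun a => hJ _ _ _ (h a)
  | mayWith I hI f g σ h =>
    simp only [dual_wth]; exact .mayPlus I hI _ _ _ fun a => hJ _ _ _ (h a)
  | mayTensor U S T σ h => simp only [dual_tensor]; exact .mayPar _ _ _ _ (hJ _ _ _ h)
  | mayPar U S T σ h => simp only [dual_par]; exact .mayTensor _ _ _ _ (hJ _ _ _ h)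

theorem FinDeriv.dual {S : SessionType Tag} {α T} (h : FinDeriv S α T) :
    FinDeriv S.dual α.dual T.dual := by
  induction h with
  | must h => exact .must h.dual
  | mayPlus I hI f g σ _ ih => simp only [dual_plus]; exact .mayWith I hI _ _ _ ih
  | mayWith I hI f g σ _ ih => simp only [dual_wth]; exact .mayPlus I hI _ _ _ ih
  | mayTensor U S T σ _ ih => simp only [dual_tensor]; exact .mayPar _ _ _ _ ih
  | mayPar U S T σ _ ih => simp only [dual_par]; exact .mayTensor _ _ _ _ ih
  | fairPlus I hI f g σ k _ ih => simp only [dual_plus]; exact .fairWith I hI _ _ _ k ih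
  | fairWith I hI f g σ k _ ih => simp only [dual_wth]; exact .fairPlus I hI _ _ _ k ih

theorem Trans.dual {S : SessionType Tag} {α T} (h : Trans S α T) :
    Trans S.dual α.dual T.dual := by
  refine ⟨fun A β B => ∃ S α T, Trans S α T ∧ A = S.dual ∧ β = α.dual ∧ B = T.dual,
    ⟨S, α, T, h, rfl, rfl, rfl⟩, ?_⟩
  rintro _ _ _ ⟨S, α, T, h, rfl, rfl, rfl⟩
  exact ⟨Rule.dual (fun S α T h => ⟨S, α, T, h, rfl, rfl, rfl⟩) (trans_iff.1 h), h.finDeriv.dual⟩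

/-- Correct composition is itself a correct composition relation. -/
theorem isCorrectComposition_correct : IsCorrectComposition (Correct (Tag := Tag)) where
  pp := fun S T ⟨_, hR, h⟩ => hR.pp S T h
  oi := fun S T ⟨R, hR, h⟩ σ hσ S' hS => by
    obtain ⟨T', hT, h'⟩ := hR.oi S T h σ hσ S' hS
    exact ⟨T', hT, R, hR, h'⟩
  io := fun S T ⟨R, hR, h⟩ σ hσ T' hT => by
    obtain ⟨S', hS, h'⟩ := hR.io S T h σ hσ T' hT
    exact ⟨S', hS, R, hR, h'⟩
  ois := fun S T ⟨R, hR, h⟩ S₁ S₂ hS => by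
    obtain ⟨T₁, T₂, hT, h₁, h₂⟩ := hR.ois S T h S₁ S₂ hS
    exact ⟨T₁, T₂, hT, ⟨R, hR, h₁⟩, R, hR, h₂⟩
  ios := fun S T ⟨R, hR, h⟩ T₁ T₂ hT => by
    obtain ⟨S₁, S₂, hS, h₁, h₂⟩ := hR.ios S T h T₁ T₂ hT
    exact ⟨S₁, S₂, hS, ⟨R, hR, h₁⟩, R, hR, h₂⟩

theorem Trans.dual_basic {S T : SessionType Tag} {σ : Message Tag} (hσ : σ.IsBasic) :
    (Trans S (.out σ) T → Trans S.dual (.inp σ) T.dual) ∧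
      (Trans S (.inp σ) T → Trans S.dual (.out σ) T.dual) :=
  ⟨fun h => by simpa only [Label.dual, hσ.dual_eq] using h.dual,
    fun h => by simpa only [Label.dual, hσ.dual_eq] using h.dual⟩

/-- Every session type is correctly composed with its dual. -/
theorem correct_dual (S : SessionType Tag) : Correct S S.dual := by
  refine ⟨fun A B => B = A.dual, ⟨?_, ?_, ?_, ?_, ?_⟩, rfl⟩
  · rintro S _ rfl
    rw [pos_dual]
    exact em _
  · rintro S _ rfl σ hσ S' h
    exact ⟨_, (Trans.dual_basic hσ).1 h, rfl⟩
  · rintro S _ rfl σ hσ T' h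
    refine ⟨T'.dual, ?_, (dual_dual _).symm⟩
    simpa only [dual_dual] using (Trans.dual_basic hσ).1 h
  · rintro S _ rfl S₁ S₂ h
    exact ⟨_, _, h.dual, rfl, rfl⟩
  · rintro S _ rfl T₁ T₂ h
    refine ⟨T₁.dual, T₂.dual, ?_, (dual_dual _).symm, (dual_dual _).symm⟩
    have h' := h.dual
    rw [dual_dual] at h'
    exact h'

/-- Correct composition is closed under cut: the inputs of `T` mirror the outputs of its dual, so
each exchange between `R` and `S` factors through `T` and `T.dual`. -/
theorem Correct.cut {R S T : SessionType Tag} (h₁ : Correct R T) (h₂ : Correct T.dual S) :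
    Correct R S := by
  have hC := isCorrectComposition_correct (Tag := Tag)
  refine ⟨fun R S => ∃ T, Correct R T ∧ Correct T.dual S, ⟨?_, ?_, ?_, ?_, ?_⟩, T, h₁, h₂⟩
  · rintro R S ⟨T, h₁, h₂⟩
    have h₃ := hC.pp _ _ h₁
    have h₄ := hC.pp _ _ h₂
    rw [pos_dual] at h₄
    tauto
  · rintro R S ⟨T, h₁, h₂⟩ σ hσ R' hR
    obtain ⟨T', hT, h₁'⟩ := hC.oi _ _ h₁ σ hσ R' hR
    obtain ⟨S', hS, h₂'⟩ := hC.oi _ _ h₂ σ hσ _ ((Trans.dual_basic hσ).2 hT)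
    exact ⟨S', hS, T', h₁', h₂'⟩
  · rintro R S ⟨T, h₁, h₂⟩ σ hσ S' hS
    obtain ⟨T', hT, h₂'⟩ := hC.io _ _ h₂ σ hσ S' hS
    have hT' := (Trans.dual_basic hσ).2 hT
    rw [dual_dual] at hT'
    obtain ⟨R', hR, h₁'⟩ := hC.io _ _ h₁ σ hσ _ hT'
    exact ⟨R', hR, T'.dual, h₁', by rwa [dual_dual]⟩
  · rintro R S ⟨T, h₁, h₂⟩ R₁ R₂ hR
    obtain ⟨T₁, T₂, hT, h₁', h₁''⟩ := hC.ois _ _ h₁ R₁ R₂ hR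
    obtain ⟨S₁, S₂, hS, h₂', h₂''⟩ := hC.ois _ _ h₂ _ _ hT.dual
    exact ⟨S₁, S₂, hS, ⟨T₁, h₁', h₂'⟩, T₂, h₁'', h₂''⟩
  · rintro R S ⟨T, h₁, h₂⟩ S₁ S₂ hS
    obtain ⟨T₁, T₂, hT, h₂', h₂''⟩ := hC.ios _ _ h₂ S₁ S₂ hS
    have hT' := hT.dual
    rw [dual_dual] at hT'
    obtain ⟨R₁, R₂, hR, h₁', h₁''⟩ := hC.ios _ _ h₁ _ _ hT'
    exact ⟨R₁, R₂, hR, ⟨T₁.dual, h₁', by rwa [dual_dual]⟩, T₂.dual, h₁'', by rwa [dual_dual]⟩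

/-- Correct composition is an instance of subtyping: `S` is correctly composed with `S.dual`, and
the converse is cut. -/
theorem correct_iff_subtyping {S T : SessionType Tag} : Correct S T ↔ Subtyping T S.dual := by
  constructor
  · exact fun h R hR => hR.cut (by rwa [dual_dual])
  · exact fun h => h S (correct_dual S)

/-! ### Session types that exchange tags only -/

/-- All roots of `T` are branchings, and all output tags of `T` are in `Γ`. -/
def IsTagged (Γ : Finset Tag) (T : SessionType Tag) : Prop :=
  ∃ P : SessionType Tag → Prop, P T ∧ ∀ T, P T →
    (∃ I hI f, T = wth I hI f ∧ ∀ a, P (f a)) ∨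
      ∃ I hI f, T = plus I hI f ∧ I ⊆ Γ ∧ ∀ a, P (f a)

theorem IsTagged.cases {Γ : Finset Tag} {T : SessionType Tag} (h : IsTagged Γ T) :
    (∃ I hI f, T = wth I hI f ∧ ∀ a, IsTagged Γ (f a)) ∨
      ∃ I hI f, T = plus I hI f ∧ I ⊆ Γ ∧ ∀ a, IsTagged Γ (f a) := by
  obtain ⟨P, hT, hP⟩ := h
  rcases hP T hT with ⟨I, hI, f, h, hf⟩ | ⟨I, hI, f, h, hΓ, hf⟩
  · exact .inl ⟨I, hI, f, h, fun a => ⟨P, hf a, hP⟩⟩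
  · exact .inr ⟨I, hI, f, h, hΓ, fun a => ⟨P, hf a, hP⟩⟩

theorem IsTagged.wth {Γ I : Finset Tag} {hI f} (h : ∀ a, IsTagged Γ (f a)) :
    IsTagged Γ (wth I hI f) := by
  refine ⟨fun T => IsTagged Γ T ∨ T = SessionType.wth I hI f, .inr rfl, ?_⟩
  rintro T (hT | rfl)
  · rcases hT.cases with ⟨I, hI, f, h, hf⟩ | ⟨I, hI, f, h, hΓ, hf⟩
    · exact .inl ⟨I, hI, f, h, fun a => .inl (hf a)⟩
    · exact .inr ⟨I, hI, f, h, hΓ, fun a => .inl (hf a)⟩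
  · exact .inl ⟨I, hI, f, rfl, fun a => .inl (h a)⟩

theorem IsTagged.plus {Γ I : Finset Tag} {hI f} (hΓ : I ⊆ Γ) (h : ∀ a, IsTagged Γ (f a)) :
    IsTagged Γ (plus I hI f) := by
  refine ⟨fun T => IsTagged Γ T ∨ T = SessionType.plus I hI f, .inr rfl, ?_⟩
  rintro T (hT | rfl)
  · rcases hT.cases with ⟨I, hI, f, h, hf⟩ | ⟨I, hI, f, h, hΓ, hf⟩
    · exact .inl ⟨I, hI, f, h, fun a => .inl (hf a)⟩
    · exact .inr ⟨I, hI, f, h, hΓ, fun a => .inl (hf a)⟩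
  · exact .inr ⟨I, hI, f, rfl, hΓ, fun a => .inl (h a)⟩

/-- The finite derivation of an output ends in an axiom for `⊕`. -/
theorem IsTagged.output {Γ : Finset Tag} {T : SessionType Tag} {σ T'} (h : IsTagged Γ T)
    (hT : Trans T (.out σ) T') : ∃ a ∈ Γ, σ = .tag a := by
  have hd := hT.finDeriv
  clear hT
  generalize hα : Label.out σ = α at hd
  induction hd with
  | must hm =>
    cases hm with
    | plus I hI f a =>
      cases hα
      rcases h.cases with ⟨I', hI', f', h', _⟩ | ⟨I', hI', f', h', hΓ, _⟩
      · cases shape_eq_of_mk_eq h'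
      · obtain ⟨rfl, _⟩ := plus_inj h'
        exact ⟨a.1, hΓ a.2, rfl⟩
    | one => rcases h.cases with ⟨_, _, _, h', _⟩ | ⟨_, _, _, h', _⟩ <;> cases shape_eq_of_mk_eq h'
    | tensor =>
      rcases h.cases with ⟨_, _, _, h', _⟩ | ⟨_, _, _, h', _⟩ <;> cases shape_eq_of_mk_eq h'
    | _ => cases hα
  | mayWith I hI f g σ' _ ih =>
    rcases h.cases with ⟨I', hI', f', h', hf⟩ | ⟨I', hI', f', h', _, hf⟩
    · obtain ⟨rfl, ⟨⟩⟩ := wth_inj h'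
      exact ih ⟨_, hI.choose_spec⟩ (hf _) hα
    · cases shape_eq_of_mk_eq h'
  | fairWith I hI f g σ' k _ ih =>
    rcases h.cases with ⟨I', hI', f', h', hf⟩ | ⟨I', hI', f', h', _, hf⟩
    · obtain ⟨rfl, ⟨⟩⟩ := wth_inj h'
      exact ih (hf _) hα
    · cases shape_eq_of_mk_eq h'
  | mayPar =>
    rcases h.cases with ⟨_, _, _, h', _⟩ | ⟨_, _, _, h', _⟩ <;> cases shape_eq_of_mk_eq h'
  | _ => cases hα

theorem IsTagged.trans_out {Γ : Finset Tag} {T : SessionType Tag} {σ T'} (h : IsTagged Γ T)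
    (hT : Trans T (.out σ) T') : IsTagged Γ T' := by
  refine ⟨fun T' => IsTagged Γ T' ∨ ∃ T, IsTagged Γ T ∧ Trans T (.out σ) T', .inr ⟨T, h, hT⟩, ?_⟩
  rintro U (hU | ⟨T, h, hT⟩)
  · rcases hU.cases with ⟨I, hI, f, h, hf⟩ | ⟨I, hI, f, h, hΓ, hf⟩
    · exact .inl ⟨I, hI, f, h, fun a => .inl (hf a)⟩
    · exact .inr ⟨I, hI, f, h, hΓ, fun a => .inl (hf a)⟩
  · rcases h.cases with ⟨I, hI, f, rfl, hf⟩ | ⟨I, hI, f, rfl, hΓ, hf⟩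
    · obtain ⟨g, rfl, hg⟩ := trans_wth_out.1 hT
      exact .inl ⟨I, hI, g, rfl, fun a => .inr ⟨_, hf a, hg a⟩⟩
    · obtain ⟨a, _, rfl⟩ := trans_plus_out.1 hT
      rcases (hf a).cases with ⟨I, hI, f, h, hf⟩ | ⟨I, hI, f, h, hΓ, hf⟩
      · exact .inl ⟨I, hI, f, h, fun a => .inl (hf a)⟩
      · exact .inr ⟨I, hI, f, h, hΓ, fun a => .inl (hf a)⟩

/-- Early outputs commute with inputs. -/
theorem IsTagged.diamond {Γ : Finset Tag} {T T₁ T₂ : SessionType Tag} {σ τ} (h : IsTagged Γ T)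
    (h₁ : Trans T (.out σ) T₁) (h₂ : Trans T (.inp τ) T₂) :
    ∃ T₃, Trans T₁ (.inp τ) T₃ ∧ Trans T₂ (.out σ) T₃ := by
  rcases h.cases with ⟨I, hI, f, rfl, hf⟩ | ⟨I, hI, f, rfl, hΓ, hf⟩
  · obtain ⟨g, rfl, hg⟩ := trans_wth_out.1 h₁
    obtain ⟨a, rfl, rfl⟩ := trans_wth_inp.1 h₂
    exact ⟨g a, trans_wth_inp.2 ⟨a, rfl, rfl⟩, hg a⟩
  · obtain ⟨g, rfl, hg⟩ := trans_plus_inp.1 h₂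
    obtain ⟨a, rfl, rfl⟩ := trans_plus_out.1 h₁
    exact ⟨g a, hg a, trans_plus_out.2 ⟨a, rfl, rfl⟩⟩

/-- Between session types that exchange tags only, the conditions on the exchange of channels are
void. -/
theorem isCorrectComposition_of_isTagged {Γ : Finset Tag}
    {R : SessionType Tag → SessionType Tag → Prop}
    (tagged : ∀ S T, R S T → IsTagged Γ S ∧ IsTagged Γ T)
    (pp : ∀ S T, R S T → Pos S ∨ Pos T)
    (oi : ∀ S T, R S T → ∀ a ∈ Γ, ∀ S', Trans S (.out (.tag a)) S' →
      ∃ T', Trans T (.inp (.tag a)) T' ∧ R S' T')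
    (io : ∀ S T, R S T → ∀ a ∈ Γ, ∀ T', Trans T (.out (.tag a)) T' →
      ∃ S', Trans S (.inp (.tag a)) S' ∧ R S' T') : IsCorrectComposition R where
  pp := pp
  oi S T h σ _ S' hS := by
    obtain ⟨a, ha, rfl⟩ := (tagged S T h).1.output hS
    exact oi S T h a ha S' hS
  io S T h σ _ T' hT := by
    obtain ⟨a, ha, rfl⟩ := (tagged S T h).2.output hT
    exact io S T h a ha T' hT
  ois S T h S₁ S₂ hS := by
    obtain ⟨a, _, h⟩ := (tagged S T h).1.output hS
    cases h
  ios S T h S₁ S₂ hS := by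
    obtain ⟨a, _, h⟩ := (tagged S T h).2.output hS
    cases h

/-- `Outputs T v T'`: from `T`, the possibly early outputs `v` lead to `T'`. -/
def Outputs : SessionType Tag → List Tag → SessionType Tag → Prop
  | T, [], T' => T' = T
  | T, a :: v, T' => ∃ T₁, Trans T (.out (.tag a)) T₁ ∧ Outputs T₁ v T'

theorem Outputs.snoc {T T' T'' : SessionType Tag} {v : List Tag} {a : Tag} (h : Outputs T v T')
    (h' : Trans T' (.out (.tag a)) T'') : Outputs T (v ++ [a]) T'' := by
  induction v generalizing T with
  | nil => exact ⟨T'', by rwa [← show T' = T from h], rfl⟩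
  | cons b v ih =>
    obtain ⟨T₁, h₁, h₂⟩ := h
    exact ⟨T₁, h₁, ih h₂⟩

theorem Outputs.isTagged {Γ : Finset Tag} {T T' : SessionType Tag} {v : List Tag}
    (h : Outputs T v T') (hT : IsTagged Γ T) : IsTagged Γ T' := by
  induction v generalizing T with
  | nil => rwa [show T' = T from h]
  | cons b v ih =>
    obtain ⟨T₁, h₁, h₂⟩ := h
    exact ih h₂ (hT.trans_out h₁)

theorem Outputs.diamond {Γ : Finset Tag} {T T' T₂ : SessionType Tag} {v : List Tag} {σ}
    (h : Outputs T v T') (hT : IsTagged Γ T) (h₂ : Trans T (.inp σ) T₂) :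
    ∃ T₃, Trans T' (.inp σ) T₃ ∧ Outputs T₂ v T₃ := by
  induction v generalizing T T₂ with
  | nil => exact ⟨T₂, by rwa [show T' = T from h], rfl⟩
  | cons b v ih =>
    obtain ⟨T₁, h₁, h⟩ := h
    obtain ⟨T₃, h₃, h₄⟩ := hT.diamond h₁ h₂
    obtain ⟨T₄, h₅, h₆⟩ := ih h (hT.trans_out h₁) h₃
    exact ⟨T₄, h₅, T₃, h₄, h₆⟩

/-! ### Queue machines and the correctness of their encoding -/

namespace QueueMachine

variable (M : QueueMachine Tag)

/-- The machine empties the queue from state `q` and queue `w`. -/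
def Halts (q : M.State) (w : List M.Sym) : Prop :=
  ∃ q', Relation.ReflTransGen M.Step (q, w) (q', [])

theorem halts_nil (q : M.State) : M.Halts q [] := ⟨q, .refl⟩

variable {M} in
theorem step_iff {q : M.State} {A : M.Sym} {w : List M.Sym} {d : M.Config} :
    M.Step (q, A :: w) d ↔ d = ((M.δ q A).1, w ++ (M.δ q A).2) := by
  constructor
  · rintro ⟨p, B, α, h, rfl⟩
    cases h
    rfl
  · rintro rfl
    exact ⟨q, A, w, rfl, rfl⟩

theorem halts_cons {q : M.State} {A : M.Sym} {w : List M.Sym} :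
    M.Halts q (A :: w) ↔ M.Halts (M.δ q A).1 (w ++ (M.δ q A).2) := by
  constructor
  · rintro ⟨q', h⟩
    rcases Relation.ReflTransGen.cases_head h with h | ⟨d, hd, h⟩
    · cases h
    · rw [step_iff] at hd
      exact ⟨q', hd ▸ h⟩
  · rintro ⟨q', h⟩
    exact ⟨q', h.head (step_iff.2 rfl)⟩

theorem sendAll_cons (A : M.Sym) (w : List M.Sym) (S : SessionType Tag) :
    M.sendAll (A :: w) S = send A.1 (M.sendAll w S) := rfl

theorem sendAll_append (w₁ w₂ : List M.Sym) (S : SessionType Tag) :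
    M.sendAll (w₁ ++ w₂) S = M.sendAll w₁ (M.sendAll w₂ S) := List.foldr_append

theorem trans_sendAll_inp {w : List M.Sym} {S T : SessionType Tag} {σ} :
    Trans (M.sendAll w S) (.inp σ) T ↔ ∃ S', T = M.sendAll w S' ∧ Trans S (.inp σ) S' := by
  induction w generalizing T with
  | nil =>
    constructor
    · exact fun h => ⟨T, rfl, h⟩
    · rintro ⟨S', rfl, h⟩
      exact h
  | cons A w ih =>
    rw [sendAll_cons, trans_send_inp]
    constructor
    · rintro ⟨T', rfl, h⟩
      obtain ⟨S', rfl, h'⟩ := ih.1 h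
      exact ⟨S', rfl, h'⟩
    · rintro ⟨S', rfl, h⟩
      exact ⟨_, rfl, ih.2 ⟨S', rfl, h⟩⟩

/-- A queue type enqueues its inputs. -/
theorem trans_queueType_inp {w : List M.Sym} {A : M.Sym} {T : SessionType Tag} :
    Trans (M.queueType w) (.inp (.tag A.1)) T ↔ T = M.queueType (w ++ [A]) := by
  have h : ∀ S, Trans M.queueLoop (.inp (.tag A.1)) S ↔ S = send A.1 M.queueLoop := by
    intro S
    conv_lhs => rw [queueLoop_eq]
    rw [trans_wth_inp]
    constructor
    · rintro ⟨B, hB, rfl⟩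
      rw [Message.tag.inj hB]
    · rintro rfl
      exact ⟨A, rfl, rfl⟩
  rw [queueType, trans_sendAll_inp, queueType, sendAll_append]
  constructor
  · rintro ⟨S, rfl, hS⟩
    rw [(h S).1 hS]
    rfl
  · rintro rfl
    exact ⟨_, rfl, (h _).2 rfl⟩

/-- On an input, a control type simulates one transition of the machine. -/
theorem trans_sendAll_controlType_inp {w : List M.Sym} {q : M.State} {A : M.Sym}
    {T : SessionType Tag} : Trans (M.sendAll w (M.controlType q)) (.inp (.tag A.1)) T ↔
      T = M.sendAll (w ++ (M.δ q A).2) (M.controlType (M.δ q A).1) := by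
  have h : ∀ S, Trans (M.controlType q) (.inp (.tag A.1)) S ↔
      S = M.sendAll (M.δ q A).2 (M.controlType (M.δ q A).1) := by
    intro S
    rw [controlType_eq, trans_wth_inp]
    constructor
    · rintro ⟨B, hB, rfl⟩
      obtain rfl : A = B := Subtype.ext (Message.tag.inj hB)
      rfl
    · rintro rfl
      exact ⟨A, rfl, rfl⟩
  rw [trans_sendAll_inp, sendAll_append]
  constructor
  · rintro ⟨S, rfl, hS⟩
    rw [(h S).1 hS]
  · rintro rfl
    exact ⟨_, rfl, (h _).2 rfl⟩

theorem isTagged_sendAll {w : List M.Sym} {S : SessionType Tag}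
    (h : IsTagged M.queueAlphabet S) : IsTagged M.queueAlphabet (M.sendAll w S) := by
  induction w with
  | nil => exact h
  | cons A w ih => exact .plus (Finset.singleton_subset_iff.2 A.2) fun _ => ih

theorem isTagged_queueType (w : List M.Sym) : IsTagged M.queueAlphabet (M.queueType w) := by
  refine M.isTagged_sendAll ⟨fun T => ∃ w, T = M.queueType w, ⟨[], rfl⟩, ?_⟩
  rintro _ ⟨_ | ⟨A, w⟩, rfl⟩
  · exact .inl ⟨_, _, _, M.queueLoop_eq, fun A => ⟨[A], rfl⟩⟩
  · exact .inr ⟨_, _, _, rfl, Finset.singleton_subset_iff.2 A.2, fun _ => ⟨w, rfl⟩⟩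

theorem isTagged_sendAll_controlType (w : List M.Sym) (q : M.State) :
    IsTagged M.queueAlphabet (M.sendAll w (M.controlType q)) := by
  refine M.isTagged_sendAll ⟨fun T => ∃ w q, T = M.sendAll w (M.controlType q), ⟨[], q, rfl⟩, ?_⟩
  rintro _ ⟨_ | ⟨A, w⟩, q, rfl⟩
  · exact .inl ⟨_, _, _, M.controlType_eq q, fun A => ⟨_, _, rfl⟩⟩
  · exact .inr ⟨_, _, _, rfl, Finset.singleton_subset_iff.2 A.2, fun _ => ⟨w, q, rfl⟩⟩

theorem not_pos_queueLoop : ¬ Pos M.queueLoop := by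
  rw [queueLoop_eq]
  exact not_pos_wth _ _ _

theorem not_pos_controlType (q : M.State) : ¬ Pos (M.controlType q) := by
  rw [controlType_eq]
  exact not_pos_wth _ _ _

variable {M}

/-- An accepting run of the machine drives the composition to a deadlock: the exchanges along the
run are forced. -/
theorem Halts.not_correct {q : M.State} {w : List M.Sym} (h : M.Halts q w) :
    ¬ Correct (M.queueType w) (M.controlType q) := by
  have hC := isCorrectComposition_correct (Tag := Tag)
  -- The outputs `γ` of the control type are enqueued.
  have flush : ∀ γ w S, Correct (M.queueType w) (M.sendAll γ S) →
      Correct (M.queueType (w ++ γ)) S := by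
    intro γ
    induction γ with
    | nil => exact fun w S h => by simpa [sendAll] using h
    | cons A γ ih =>
      intro w S h
      obtain ⟨S', hS, h'⟩ := hC.io _ _ h (.tag A.1) trivial _ (trans_send_out.2 ⟨rfl, rfl⟩)
      rw [trans_queueType_inp] at hS
      subst hS
      simpa using ih _ _ h'
  obtain ⟨q', h⟩ := h
  generalize hc : (q, w) = c at h
  induction h using Relation.ReflTransGen.head_induction_on generalizing q w with
  | refl =>
    cases hc
    intro h
    exact (hC.pp _ _ h).elim M.not_pos_queueLoop (M.not_pos_controlType _)
  | @head _ d hs _ ih =>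
    subst hc
    obtain ⟨p, A, α, hc, rfl⟩ := hs
    cases hc
    intro h
    obtain ⟨T', hT, h'⟩ := hC.oi _ _ h (.tag A.1) trivial _ (trans_send_out.2 ⟨rfl, rfl⟩)
    obtain rfl := (M.trans_sendAll_controlType_inp (w := [])).1 hT
    exact ih rfl (flush _ _ _ h')

/-- If there are two queue symbols, no output is possible before the first input of `Q^M`. -/
theorem not_trans_queueLoop_out (hM : ¬ Subsingleton M.Sym) {σ : Message Tag}
    {T : SessionType Tag} : ¬ Trans M.queueLoop (.out σ) T := by
  rw [queueLoop_eq, trans_wth_out]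
  rintro ⟨g, _, hg⟩
  refine hM ⟨fun A B => Subtype.ext (Message.tag.inj ?_)⟩
  rw [← (trans_send_out.1 (hg A)).1, (trans_send_out.1 (hg B)).1]

theorem correct_of_not_halts_of_not_subsingleton (hM : ¬ Subsingleton M.Sym) {q : M.State}
    {w : List M.Sym} (h : ¬ M.Halts q w) : Correct (M.queueType w) (M.controlType q) := by
  -- `v` consists of the outputs of the control type that were made early or from `γ`.
  let R : SessionType Tag → SessionType Tag → Prop := fun S T => ∃ w q γ, ∃ v : List M.Sym,
    S = M.queueType (w ++ v) ∧
      Outputs (M.sendAll γ (M.controlType q)) (v.map Subtype.val) T ∧ ¬ M.Halts q (w ++ γ)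
  -- If the queue of the machine is empty, its next symbol is the head of `γ`; if that symbol has
  -- been sent already, it is moved from `γ` and `v` to the queue.
  have out : ∀ S T, R S T → S = M.queueLoop ∧ Pos T ∨ ∃ A w q γ, ∃ v : List M.Sym,
      S = M.queueType (A :: w ++ v) ∧
        Outputs (M.sendAll γ (M.controlType q)) (v.map Subtype.val) T ∧
          ¬ M.Halts q (A :: w ++ γ) := by
    rintro _ T ⟨w, q, γ, v, rfl, hT, hh⟩
    cases w with
    | cons A w => exact .inr ⟨A, w, q, γ, v, rfl, hT, hh⟩
    | nil =>
      cases γ with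
      | nil => exact (hh (M.halts_nil q)).elim
      | cons B γ =>
        cases v with
        | nil =>
          obtain rfl : T = _ := hT
          exact .inl ⟨rfl, pos_plus _ _ _⟩
        | cons A v =>
          obtain ⟨T₁, h₁, h₂⟩ := hT
          obtain ⟨hAB, rfl⟩ := trans_send_out.1 h₁
          obtain rfl : A = B := Subtype.ext (Message.tag.inj hAB)
          exact .inr ⟨A, [], q, γ, v, rfl, h₂, hh⟩
  refine ⟨R, isCorrectComposition_of_isTagged (Γ := M.queueAlphabet) ?_ ?_ ?_ ?_,
    w, q, [], [], by simp, rfl, by simpa using h⟩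
  · rintro _ T ⟨w, q, γ, v, rfl, hT, hh⟩
    exact ⟨M.isTagged_queueType _, hT.isTagged (M.isTagged_sendAll_controlType _ _)⟩
  · intro S T h
    rcases out S T h with ⟨_, h⟩ | ⟨A, w, q, γ, v, rfl, _, _⟩
    · exact .inr h
    · exact .inl (pos_plus _ _ _)
  · intro S T h a ha S' hS
    rcases out S T h with ⟨rfl, _⟩ | ⟨A, w, q, γ, v, rfl, hT, hh⟩
    · exact (not_trans_queueLoop_out hM hS).elim
    · obtain ⟨hA, rfl⟩ := trans_send_out.1 hS
      cases hA
      obtain ⟨T', hT', hv⟩ := hT.diamond (M.isTagged_sendAll_controlType _ _)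
        (M.trans_sendAll_controlType_inp.2 rfl)
      refine ⟨T', hT', w, _, _, v, rfl, hv, ?_⟩
      rwa [List.cons_append, halts_cons, List.append_assoc] at hh
  · rintro _ T ⟨w, q, γ, v, rfl, hT, hh⟩ a ha T' hT'
    refine ⟨_, M.trans_queueType_inp (A := ⟨a, ha⟩).2 rfl, w, q, γ, v ++ [⟨a, ha⟩], by simp, ?_, hh⟩
    rw [List.map_append]
    exact hT.snoc hT'

variable (M) in
/-- `Q^M` after `k` outputs that were made before any input, if there is just one queue symbol. -/
def queueDebt : ℕ → SessionType Tag
  | 0 => M.queueLoop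
  | k + 1 => wth M.queueAlphabet M.alphabet_nonempty fun _ => queueDebt k

variable (M) in
/-- The queue of the given length over a single queue symbol; a negative length counts the early
outputs of the empty queue. -/
def unaryQueue : ℤ → SessionType Tag
  | .ofNat n => M.queueType (List.replicate n ⟨M.dollar, M.dollar_mem⟩)
  | .negSucc k => M.queueDebt (k + 1)

theorem isTagged_unaryQueue (z : ℤ) : IsTagged M.queueAlphabet (M.unaryQueue z) := by
  rcases z with n | k
  · exact M.isTagged_queueType _
  · have : ∀ k, IsTagged M.queueAlphabet (M.queueDebt k) := by
      intro k
      induction k with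
      | zero => exact M.isTagged_queueType []
      | succ k ih => exact .wth fun _ => ih
    exact this _

theorem pos_unaryQueue {z : ℤ} (hz : 0 < z) : Pos (M.unaryQueue z) := by
  obtain ⟨n, rfl⟩ := Int.eq_succ_of_zero_lt hz
  exact pos_plus _ _ _

theorem trans_unaryQueue_inp (z : ℤ) :
    Trans (M.unaryQueue z) (.inp (.tag M.dollar)) (M.unaryQueue (z + 1)) := by
  rcases z with n | k
  · refine (M.trans_queueType_inp (A := ⟨M.dollar, M.dollar_mem⟩)).2 ?_
    exact congrArg M.queueType List.replicate_succ'
  · have : M.unaryQueue (Int.negSucc k + 1) = M.queueDebt k := by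
      cases k <;> rfl
    rw [this]
    exact trans_wth_inp.2 ⟨⟨M.dollar, M.dollar_mem⟩, rfl, rfl⟩

theorem trans_queueDebt_out [Subsingleton M.Sym] {k : ℕ} {σ : Message Tag} {T : SessionType Tag}
    (h : Trans (M.queueDebt k) (.out σ) T) : T = M.queueDebt (k + 1) := by
  induction k generalizing T with
  | zero =>
    rw [queueDebt, queueLoop_eq, trans_wth_out] at h
    obtain ⟨g, rfl, hg⟩ := h
    exact congrArg _ (funext fun A => (trans_send_out.1 (hg A)).2)
  | succ k ih =>
    rw [queueDebt, trans_wth_out] at h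
    obtain ⟨g, rfl, hg⟩ := h
    exact congrArg _ (funext fun A => ih (hg A))

theorem trans_unaryQueue_out [Subsingleton M.Sym] {z : ℤ} {σ : Message Tag} {T : SessionType Tag}
    (h : Trans (M.unaryQueue z) (.out σ) T) : T = M.unaryQueue (z - 1) := by
  rcases z with (_ | n) | k
  · exact trans_queueDebt_out (k := 0) h
  · rw [(trans_send_out.1 h).2]
    exact congrArg M.unaryQueue (by simp : (n : ℤ) = Int.ofNat (n + 1) - 1)
  · exact trans_queueDebt_out h

/-- Outputs that do not exhaust `w` leave an output type. -/
theorem pos_of_outputs_sendAll {w : List M.Sym} {S T : SessionType Tag} {v : List Tag}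
    (h : Outputs (M.sendAll w S) v T) (hl : v.length < w.length) : Pos T := by
  induction w generalizing v with
  | nil => exact absurd hl (Nat.not_lt_zero _)
  | cons A w ih =>
    cases v with
    | nil =>
      obtain rfl : T = _ := h
      exact pos_plus _ _ _
    | cons b v =>
      obtain ⟨T₁, h₁, h₂⟩ := h
      obtain ⟨_, rfl⟩ := trans_send_out.1 h₁
      exact ih h₂ (Nat.lt_of_succ_lt_succ hl)

/-- With a single queue symbol, both sides may make outputs ahead of time. -/
theorem correct_of_not_halts_of_subsingleton [Subsingleton M.Sym] {q : M.State}
    {w : List M.Sym} (h : ¬ M.Halts q w) : Correct (M.queueType w) (M.controlType q) := by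
  let d : M.Sym := ⟨M.dollar, M.dollar_mem⟩
  have hrep : ∀ w : List M.Sym, w = List.replicate w.length d := fun w =>
    List.eq_replicate_iff.2 ⟨rfl, fun _ _ => Subsingleton.elim _ _⟩
  have hd : ∀ a ∈ M.queueAlphabet, a = M.dollar := fun a ha =>
    congrArg Subtype.val (Subsingleton.elim (⟨a, ha⟩ : M.Sym) d)
  -- Only the lengths matter; `n` is the length of the queue of the machine.
  let R : SessionType Tag → SessionType Tag → Prop := fun S T => ∃ (z : ℤ) (q : M.State)
    (γ : List M.Sym) (v : List Tag) (n : ℕ), S = M.unaryQueue z ∧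
      Outputs (M.sendAll γ (M.controlType q)) v T ∧ z + γ.length = n + v.length ∧
        ¬ M.Halts q (List.replicate n d)
  refine ⟨R, isCorrectComposition_of_isTagged (Γ := M.queueAlphabet) ?_ ?_ ?_ ?_,
    w.length, q, [], [], w.length, congrArg M.queueType (hrep w), rfl, by simp, ?_⟩
  · rintro _ T ⟨z, q, γ, v, n, rfl, hT, hl, hh⟩
    exact ⟨isTagged_unaryQueue z, hT.isTagged (M.isTagged_sendAll_controlType _ _)⟩
  · rintro _ T ⟨z, q, γ, v, n, rfl, hT, hl, hh⟩
    have hn : n ≠ 0 := by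
      rintro rfl
      exact hh (M.halts_nil q)
    rcases lt_or_ge 0 z with hz | hz
    · exact .inl (pos_unaryQueue hz)
    · exact .inr (pos_of_outputs_sendAll hT (by omega))
  · rintro _ T ⟨z, q, γ, v, n, rfl, hT, hl, hh⟩ a ha S' hS
    obtain rfl := hd a ha
    obtain rfl := trans_unaryQueue_out hS
    obtain ⟨T', hT', hv⟩ := hT.diamond (M.isTagged_sendAll_controlType _ _)
      ((M.trans_sendAll_controlType_inp (A := d)).2 rfl)
    cases n with
    | zero => exact (hh (M.halts_nil q)).elim
    | succ n =>
      rw [List.replicate_succ, halts_cons, hrep (_ ++ _)] at hh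
      refine ⟨T', hT', z - 1, _, _, v, _, rfl, hv, ?_, hh⟩
      simp only [List.length_append, List.length_replicate]
      push_cast
      push_cast at hl
      omega
  · rintro _ T ⟨z, q, γ, v, n, rfl, hT, hl, hh⟩ a ha T' hT'
    obtain rfl := hd a ha
    refine ⟨_, trans_unaryQueue_inp z, z + 1, q, γ, v ++ [M.dollar], n, rfl, hT.snoc hT', ?_, hh⟩
    rw [List.length_append, List.length_singleton]
    push_cast
    omega
  · rwa [← hrep w]

variable (M) in
/-- `Q^M_w` and `S^M_q` are correctly composed if and only if the machine never empties the queue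
from state `q` and queue `w`. -/
theorem correct_iff_not_halts (q : M.State) (w : List M.Sym) :
    Correct (M.queueType w) (M.controlType q) ↔ ¬ M.Halts q w := by
  refine ⟨fun h hh => hh.not_correct h, fun h => ?_⟩
  by_cases hM : Subsingleton M.Sym
  · exact correct_of_not_halts_of_subsingleton h
  · exact correct_of_not_halts_of_not_subsingleton hM h

end QueueMachine

open Turing StateTransition

/-! ### Queue transition functions -/

/-- One step of a queue transition function, as a partial function on configurations. -/
def configStep {Q A : Type} (δ : Q → A → Q × List A) : Q × List A → Option (Q × List A)
  | (_, []) => none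
  | (q, a :: w) => some ((δ q a).1, w ++ (δ q a).2)

namespace QueueMachine

theorem halts_iff_eval_dom (M : QueueMachine Tag) (q : M.State) (w : List M.Sym) :
    M.Halts q w ↔ (eval (configStep M.δ) (q, w)).Dom := by
  have hstep : M.Step = fun a b => b ∈ configStep M.δ a := by
    funext ⟨q, w⟩ d
    apply propext
    cases w with
    | nil =>
      constructor
      · rintro ⟨p, A, α, h, -⟩
        cases h
      · exact fun h => absurd h (Option.not_mem_none d)
    | cons A w =>
      rw [step_iff]
      exact ⟨fun h => h ▸ rfl, fun h => (Option.some.inj h).symm⟩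
  rw [Part.dom_iff_mem, Halts, hstep]
  constructor
  · rintro ⟨q', h⟩
    exact ⟨(q', []), mem_eval.2 ⟨h, rfl⟩⟩
  · rintro ⟨⟨q', w'⟩, h⟩
    obtain ⟨h, h'⟩ := mem_eval.1 h
    cases w' with
    | nil => exact ⟨q', h⟩
    | cons => cases h'

section OfStep

variable {Q A : Type} [Fintype A] [DecidableEq A] (e : A ↪ Tag) (δ : Q → A → Q × List A) (a₀ : A)
  (P : Set Q) (hP : P.Finite) (hδ : ∀ q ∈ P, ∀ a, (δ q a).1 ∈ P) (s : Q) (hs : s ∈ P)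

/-- The queue machine with transition function `δ`, restricted to a finite closed set `P` of
states, initial queue symbol `a₀` and start state `s`. Queue symbols are represented by tags
through `e`. -/
noncomputable def ofStep : QueueMachine Tag where
  State := P
  finite_state := hP
  queueAlphabet := Finset.univ.map e
  inputAlphabet := (Finset.univ.erase a₀).map e
  input_subset := Finset.map_subset_map.2 (Finset.subset_univ _)
  dollar := e a₀
  dollar_mem := Finset.mem_map_of_mem _ (Finset.mem_univ _)
  dollar_not_input := by simp
  start := ⟨s, hs⟩
  δ p X :=
    let c := (Finset.mem_map.1 X.2).choose
    (⟨(δ p.1 c).1, hδ _ p.2 _⟩,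
      (δ p.1 c).2.map fun a => ⟨e a, Finset.mem_map_of_mem _ (Finset.mem_univ _)⟩)

/-- The queue symbol of `ofStep` that represents `a`. -/
def ofStepSym (a : A) : (ofStep e δ a₀ P hP hδ s hs).Sym :=
  ⟨e a, Finset.mem_map_of_mem _ (Finset.mem_univ _)⟩

/-- The state of `ofStep` that is given by an element of `P`. -/
def ofStepState (p : P) : (ofStep e δ a₀ P hP hδ s hs).State := p

theorem ofStep_δ (p : P) (a : A) :
    (ofStep e δ a₀ P hP hδ s hs).δ (ofStepState e δ a₀ P hP hδ s hs p)
        (ofStepSym e δ a₀ P hP hδ s hs a) =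
      (ofStepState e δ a₀ P hP hδ s hs ⟨(δ p.1 a).1, hδ _ p.2 _⟩,
        (δ p.1 a).2.map (ofStepSym e δ a₀ P hP hδ s hs)) := by
  have : ∀ h : ∃ c, c ∈ Finset.univ ∧ e c = e a, h.choose = a := fun h =>
    e.injective h.choose_spec.2
  simp only [ofStep, ofStepSym, ofStepState, this]
  rfl

theorem ofStep_halts_iff (p : P) (w : List A) :
    (ofStep e δ a₀ P hP hδ s hs).Halts (ofStepState e δ a₀ P hP hδ s hs p)
        (w.map (ofStepSym e δ a₀ P hP hδ s hs)) ↔ (eval (configStep δ) (p.1, w)).Dom := by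
  rw [halts_iff_eval_dom]
  refine tr_eval_dom (tr := fun c d => ∃ p : P, c.1 = p.1 ∧
    d = (ofStepState e δ a₀ P hP hδ s hs p, c.2.map (ofStepSym e δ a₀ P hP hδ s hs))) ?_
    ⟨p, rfl, rfl⟩
  rintro ⟨_, w⟩ _ ⟨p, rfl, rfl⟩
  cases w with
  | nil => rfl
  | cons a w =>
    refine ⟨_, ⟨⟨(δ p.1 a).1, hδ _ p.2 _⟩, rfl, rfl⟩, Relation.TransGen.single ?_⟩
    simp only [List.map_cons, configStep, Option.mem_def, ofStep_δ, List.map_append]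

end OfStep

end QueueMachine

/-! ### Queue machines simulate stack machines -/

section StackMachine

variable {K G Λ σ : Type}

/-- Queue symbols for stack machines: marks `some (.inl k)` for the stacks, stack symbols
`some (.inr g)`, and the end mark `none`. -/
abbrev StackSym (K G : Type) : Type := Option (K ⊕ G)

/-- Control states of the queue machine that simulates a stack machine. The queue holds the
contents of all stacks, each preceded by its mark, followed by the end mark. To execute one
instruction, the machine rotates the queue once:
* `scan q v`: `q` is to be executed on the store `v`, the mark of its stack is still to be found;
* `top q v`: the mark was found, the top of the stack is read next;
* `rest q v`: done; `q` is to be executed next, when the rotation is complete. -/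
inductive SimState (Stmt σ : Type) : Type
  | scan (q : Stmt) (v : σ)
  | top (q : Stmt) (v : σ)
  | rest (q : Stmt) (v : σ)

/-- Statements of a machine with stacks `K` over the stack alphabet `G`. -/
abbrev StackStmt (K G Λ σ : Type) : Type := TM2.Stmt (fun _ : K => G) Λ σ

/-- Copy a symbol, while completing the rotation before `q` is executed on `v`. -/
def pass {Stmt : Type} (q : Stmt) (v : σ) : StackSym K G → SimState Stmt σ × List (StackSym K G)
  | none => (.scan q v, [none])
  | some c => (.rest q v, [some c])

/-- The statement in a control state. -/
def SimState.stmt {Stmt : Type} : SimState Stmt σ → Stmt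
  | .scan q _ => q
  | .top q _ => q
  | .rest q _ => q

theorem SimState.finite_of_stmt [Finite σ] {Stmt : Type} {S : Set Stmt} (hS : S.Finite) :
    {p : SimState Stmt σ | p.stmt ∈ S}.Finite := by
  have hp := hS.prod (Set.finite_univ (α := σ))
  refine (((hp.image fun x => SimState.scan x.1 x.2).union
    (hp.image fun x => SimState.top x.1 x.2)).union
    (hp.image fun x => SimState.rest x.1 x.2)).subset ?_
  rintro (⟨q, v⟩ | ⟨q, v⟩ | ⟨q, v⟩) h
  · exact .inl (.inl ⟨(q, v), ⟨h, trivial⟩, rfl⟩)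
  · exact .inl (.inr ⟨(q, v), ⟨h, trivial⟩, rfl⟩)
  · exact .inr ⟨(q, v), ⟨h, trivial⟩, rfl⟩

theorem pass_stmt {Stmt : Type} (q : Stmt) (v : σ) (c : StackSym K G) :
    (pass q v c).1.stmt = q := by
  cases c <;> rfl

section

variable [Fintype K]

/-- The queue that represents the contents `S` of the stacks, without the end mark. -/
noncomputable def stackQueue (S : K → List G) : List (StackSym K G) :=
  Finset.univ.toList.flatMap fun k => some (.inl k) :: (S k).map fun g => some (.inr g)

theorem none_not_mem_stackQueue (S : K → List G) : none ∉ stackQueue S := by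
  simp [stackQueue]

end

variable [DecidableEq K]

/-- The transition function that simulates the stack machine with program `tr`. -/
def simStep (tr : Λ → StackStmt K G Λ σ) : SimState (StackStmt K G Λ σ) σ → StackSym K G →
    SimState (StackStmt K G Λ σ) σ × List (StackSym K G)
  | .rest q v, c => pass q v c
  | .scan (.push k f q) v, some (.inl k') =>
    if k' = k then (.rest q v, [some (.inl k), some (.inr (f v))])
    else (.scan (.push k f q) v, [some (.inl k')])
  | .scan (.peek k f q) v, some (.inl k') =>
    if k' = k then (.top (.peek k f q) v, [some (.inl k)])
    else (.scan (.peek k f q) v, [some (.inl k')])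
  | .scan (.pop k f q) v, some (.inl k') =>
    if k' = k then (.top (.pop k f q) v, [some (.inl k)])
    else (.scan (.pop k f q) v, [some (.inl k')])
  | .scan (.load a q) v, c => pass q (a v) c
  | .scan (.branch f q₁ q₂) v, c => pass (cond (f v) q₁ q₂) v c
  | .scan (.goto l) v, c => pass (tr (l v)) v c
  | .scan .halt v, _ => (.scan .halt v, [])
  | .scan q v, c => (.scan q v, [c])
  | .top (.peek _ f q) v, some (.inr g) => (.rest q (f v (some g)), [some (.inr g)])
  | .top (.peek _ f q) v, c => pass q (f v none) c
  | .top (.pop _ f q) v, some (.inr g) => (.rest q (f v (some g)), [])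
  | .top (.pop _ f q) v, c => pass q (f v none) c
  | .top q v, c => pass q v c

/-- A step of the simulation stays at the same statement, proceeds to a substatement, or follows a
jump. -/
theorem simStep_stmt (tr : Λ → StackStmt K G Λ σ) (p : SimState (StackStmt K G Λ σ) σ)
    (c : StackSym K G) : (simStep tr p c).1.stmt ∈ TM2.stmts₁ p.stmt ∨
      ∃ l v, p.stmt = .goto l ∧ (simStep tr p c).1.stmt = tr (l v) := by
  have hself : ∀ q : StackStmt K G Λ σ, q ∈ TM2.stmts₁ q := fun q => TM2.stmts₁_self
  rcases p with ⟨q, v⟩ | ⟨q, v⟩ | ⟨q, v⟩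
  · cases q with
    | goto l => exact .inr ⟨l, v, rfl, pass_stmt _ _ _⟩
    | branch f q₁ q₂ =>
      refine .inl ?_
      rw [simStep, pass_stmt]
      cases f v <;> simp [SimState.stmt, TM2.stmts₁, hself]
    | load a q =>
      refine .inl ?_
      rw [simStep, pass_stmt]
      simp [SimState.stmt, TM2.stmts₁, hself]
    | halt => exact .inl (hself _)
    | _ k f q =>
      refine .inl ?_
      rcases c with _ | k' | g
      · exact hself _
      · simp only [simStep]
        split_ifs <;> simp [SimState.stmt, TM2.stmts₁, hself]
      · exact hself _
  · refine .inl ?_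
    cases q with
    | peek k f q | pop k f q =>
      rcases c with _ | k' | g <;> simp [simStep, pass, SimState.stmt, TM2.stmts₁, hself]
    | _ =>
      simp only [simStep, pass_stmt]
      exact hself _
  · refine .inl ?_
    rw [simStep, pass_stmt]
    exact hself _

/-- Only finitely many control states occur if the program uses finitely many labels only. -/
theorem simStep_stmt_mem [Inhabited Λ] {tr : Λ → StackStmt K G Λ σ} {S : Finset Λ}
    (hS : TM2.Supports tr S) (p : SimState (StackStmt K G Λ σ) σ)
    (hp : some p.stmt ∈ TM2.stmts tr S) (c : StackSym K G) :
    some (simStep tr p c).1.stmt ∈ TM2.stmts tr S := by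
  rcases simStep_stmt tr p c with h | ⟨l, v, hl, h⟩
  · exact TM2.stmts_trans h hp
  · have hlS := TM2.stmts_supportsStmt hS hp
    rw [hl] at hlS
    rw [h]
    simp only [TM2.stmts, Finset.mem_insertNone, Finset.mem_biUnion, Option.mem_def,
      Option.some.injEq, forall_eq']
    exact ⟨l v, hlS v, TM2.stmts₁_self⟩

/-- Copying a prefix of the queue to its end. -/
theorem reaches_copy {Q A : Type} {δ : Q → A → Q × List A} {p : Q} {l : List A} (r : List A)
    (h : ∀ c ∈ l, δ p c = (p, [c])) : Reaches (configStep δ) (p, l ++ r) (p, r ++ l) := by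
  induction l generalizing r with
  | nil => rw [List.nil_append, List.append_nil]; exact .refl
  | cons c l ih =>
    have := ih (r ++ [c]) fun c hc => h c (List.mem_cons_of_mem _ hc)
    refine .head (b := (p, l ++ (r ++ [c]))) ?_ (by simpa [Reaches] using this)
    simp [configStep, h c List.mem_cons_self]

theorem simulate_halt (tr : Λ → StackStmt K G Λ σ) (v : σ) (w : List (StackSym K G)) :
    Reaches (configStep (simStep tr)) (.scan .halt v, w) (.scan .halt v, []) := by
  induction w with
  | nil => exact .refl
  | cons c w ih =>
    exact .head (b := (SimState.scan TM2.Stmt.halt v, w)) (by simp [configStep, simStep]) ih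

/-- Completing the rotation of the queue, from a state that treats the next symbol as `pass`. -/
theorem reaches_pass {tr : Λ → StackStmt K G Λ σ} {p : SimState (StackStmt K G Λ σ) σ}
    {q : StackStmt K G Λ σ} {v : σ} {l : List (StackSym K G)} (r : List (StackSym K G))
    (hl : none ∉ l) (h : ∀ c ∈ (l ++ [none]).head?, simStep tr p c = pass q v c) :
    Reaches₁ (configStep (simStep tr)) (p, l ++ none :: r) (.scan q v, r ++ l ++ [none]) := by
  induction l generalizing p r with
  | nil =>
    refine .single ?_
    simp [configStep, h none rfl, pass]
  | cons c l ih =>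
    have hc := h c rfl
    cases c with
    | none => exact absurd List.mem_cons_self hl
    | some c =>
      have := ih (p := .rest q v) (r ++ [some c]) (fun h => hl (List.mem_cons_of_mem _ h))
        fun _ _ => rfl
      refine .head (b := (.rest q v, l ++ none :: (r ++ [some c]))) ?_
        (by simpa [Reaches₁] using this)
      simp [configStep, hc, pass]

variable [Fintype K]

/-- The part of the queue that represents stack `k`, and the rest, which does not depend on its
contents. After it comes a mark or nothing, so that the bottom of the stack can be recognised. -/
theorem stackQueue_split (S : K → List G) (k : K) : ∃ l₁ l₂ : List (StackSym K G),
    none ∉ l₁ ∧ some (.inl k) ∉ l₁ ∧ none ∉ l₂ ∧ (∀ g, l₂.head? ≠ some (some (.inr g))) ∧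
      ∀ L, stackQueue (Function.update S k L) =
        l₁ ++ some (.inl k) :: L.map (fun g => some (.inr g)) ++ l₂ := by
  obtain ⟨ks₁, ks₂, hks⟩ := List.append_of_mem (Finset.mem_toList.2 (Finset.mem_univ k))
  have hnd := (Finset.univ (α := K)).nodup_toList
  rw [hks, List.nodup_append] at hnd
  obtain ⟨_, h₂, h₃⟩ := hnd
  have h₁ : k ∉ ks₁ := fun h => h₃ k h k List.mem_cons_self rfl
  replace h₂ : k ∉ ks₂ := (List.nodup_cons.1 h₂).1
  refine ⟨ks₁.flatMap fun k => some (.inl k) :: (S k).map fun g => some (.inr g),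
    ks₂.flatMap fun k => some (.inl k) :: (S k).map fun g => some (.inr g),
    by simp, by simpa using h₁, by simp, ?_, fun L => ?_⟩
  · intro g
    cases ks₂ <;> simp
  · have aux : ∀ ks : List K, k ∉ ks →
        (ks.flatMap fun k' => some (.inl k') ::
          (Function.update S k L k').map fun g => (some (.inr g) : StackSym K G)) =
        ks.flatMap fun k => some (.inl k) :: (S k).map fun g => some (.inr g) := by
      intro ks hk
      refine List.flatMap_congr fun k' hk' => ?_
      rw [Function.update_of_ne (ne_of_mem_of_not_mem hk' hk)]
    rw [stackQueue, hks, List.flatMap_append, List.flatMap_cons, aux _ h₁, aux _ h₂,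
      Function.update_self, List.append_assoc]

/-- The queue configurations that represent a configuration of the stack machine. The queue is
empty if the stack machine has halted. -/
def SimCfg (tr : Λ → StackStmt K G Λ σ) : TM2.Cfg (fun _ : K => G) Λ σ →
    SimState (StackStmt K G Λ σ) σ × List (StackSym K G) → Prop
  | ⟨some l, v, S⟩, c => c = (.scan (tr l) v, stackQueue S ++ [none])
  | ⟨none, _, _⟩, c => c.2 = []

theorem simulate_push (tr : Λ → StackStmt K G Λ σ) (k : K) (f : σ → G) (q : StackStmt K G Λ σ)
    (v : σ) (S : K → List G) :
    Reaches₁ (configStep (simStep tr)) (.scan (.push k f q) v, stackQueue S ++ [none])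
      (.scan q v, stackQueue (Function.update S k (f v :: S k)) ++ [none]) := by
  obtain ⟨l₁, l₂, h₁, h₁', h₂, _, h⟩ := stackQueue_split S k
  have hS := h (S k)
  rw [Function.update_eq_self] at hS
  rw [hS, h]
  simp only [List.append_assoc, List.cons_append]
  refine Relation.TransGen.trans_right (reaches_copy _ ?_) ?_
  · rintro (_ | k' | g) hc
    · rfl
    · have : k' ≠ k := by
        rintro rfl
        exact h₁' hc
      simp [simStep, this]
    · rfl
  · refine .head (b := (.rest q v, ((S k).map fun g => some (.inr g)) ++ l₂ ++
      none :: (l₁ ++ [some (.inl k), some (.inr (f v))]))) (by simp [configStep, simStep]) ?_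
    have := reaches_pass (tr := tr) (p := .rest q v) (q := q) (v := v)
      (l := ((S k).map fun g => some (.inr g)) ++ l₂)
      (l₁ ++ [some (.inl k), some (.inr (f v))]) (by simpa using h₂) fun _ _ => rfl
    simpa [Reaches₁] using this

theorem simulate_peek (tr : Λ → StackStmt K G Λ σ) (k : K) (f : σ → Option G → σ)
    (q : StackStmt K G Λ σ) (v : σ) (S : K → List G) :
    Reaches₁ (configStep (simStep tr)) (.scan (.peek k f q) v, stackQueue S ++ [none])
      (.scan q (f v (S k).head?), stackQueue S ++ [none]) := by
  obtain ⟨l₁, l₂, h₁, h₁', h₂, hl, h⟩ := stackQueue_split S k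
  have hS := h (S k)
  rw [Function.update_eq_self] at hS
  rw [hS]
  simp only [List.append_assoc, List.cons_append]
  refine Relation.TransGen.trans_right (reaches_copy _ ?_) ?_
  · rintro (_ | k' | g) hc
    · rfl
    · have : k' ≠ k := by
        rintro rfl
        exact h₁' hc
      simp [simStep, this]
    · rfl
  refine .head (b := (.top (.peek k f q) v, ((S k).map fun g => some (.inr g)) ++ l₂ ++
      none :: (l₁ ++ [some (.inl k)]))) (by simp [configStep, simStep]) ?_
  cases S k with
  | nil =>
    have := reaches_pass (tr := tr) (p := .top (.peek k f q) v) (q := q) (v := f v none)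
      (l := l₂) (l₁ ++ [some (.inl k)]) h₂ ?_
    · simpa [Reaches₁] using this
    · rintro (_ | k' | g) hc
      · rfl
      · rfl
      · cases l₂ with
        | nil => cases hc
        | cons c l₂ => exact absurd hc (hl g)
  | cons g L =>
    refine .head (b := (.rest q (f v (some g)), (L.map fun g => some (.inr g)) ++ l₂ ++
      none :: (l₁ ++ [some (.inl k), some (.inr g)]))) (by simp [configStep, simStep]) ?_
    have := reaches_pass (tr := tr) (p := .rest q (f v (some g))) (q := q) (v := f v (some g))
      (l := (L.map fun g => some (.inr g)) ++ l₂)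
      (l₁ ++ [some (.inl k), some (.inr g)]) (by simpa using h₂) fun _ _ => rfl
    simpa [Reaches₁] using this

theorem simulate_pop (tr : Λ → StackStmt K G Λ σ) (k : K) (f : σ → Option G → σ)
    (q : StackStmt K G Λ σ) (v : σ) (S : K → List G) :
    Reaches₁ (configStep (simStep tr)) (.scan (.pop k f q) v, stackQueue S ++ [none])
      (.scan q (f v (S k).head?), stackQueue (Function.update S k (S k).tail) ++ [none]) := by
  obtain ⟨l₁, l₂, h₁, h₁', h₂, hl, h⟩ := stackQueue_split S k
  have hS := h (S k)
  rw [Function.update_eq_self] at hS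
  rw [hS, h]
  simp only [List.append_assoc, List.cons_append]
  refine Relation.TransGen.trans_right (reaches_copy _ ?_) ?_
  · rintro (_ | k' | g) hc
    · rfl
    · have : k' ≠ k := by
        rintro rfl
        exact h₁' hc
      simp [simStep, this]
    · rfl
  refine .head (b := (.top (.pop k f q) v, ((S k).map fun g => some (.inr g)) ++ l₂ ++
      none :: (l₁ ++ [some (.inl k)]))) (by simp [configStep, simStep]) ?_
  cases S k with
  | nil =>
    have := reaches_pass (tr := tr) (p := .top (.pop k f q) v) (q := q) (v := f v none)
      (l := l₂) (l₁ ++ [some (.inl k)]) h₂ ?_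
    · simpa [Reaches₁] using this
    · rintro (_ | k' | g) hc
      · rfl
      · rfl
      · cases l₂ with
        | nil => cases hc
        | cons c l₂ => exact absurd hc (hl g)
  | cons g L =>
    refine .head (b := (.rest q (f v (some g)), (L.map fun g => some (.inr g)) ++ l₂ ++
      none :: (l₁ ++ [some (.inl k)]))) (by simp [configStep, simStep]) ?_
    have := reaches_pass (tr := tr) (p := .rest q (f v (some g))) (q := q) (v := f v (some g))
      (l := (L.map fun g => some (.inr g)) ++ l₂)
      (l₁ ++ [some (.inl k)]) (by simpa using h₂) fun _ _ => rfl
    simpa [Reaches₁] using this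

theorem simulate_pass (tr : Λ → StackStmt K G Λ σ) {p : SimState (StackStmt K G Λ σ) σ}
    {q : StackStmt K G Λ σ} {v : σ} (S : K → List G) (h : ∀ c, simStep tr p c = pass q v c) :
    Reaches₁ (configStep (simStep tr)) (p, stackQueue S ++ [none])
      (.scan q v, stackQueue S ++ [none]) := by
  simpa using reaches_pass (l := stackQueue S) [] (none_not_mem_stackQueue S) fun c _ => h c

/-- The simulation of a whole statement, up to the next jump or the drained queue. -/
theorem simulate_stepAux (tr : Λ → StackStmt K G Λ σ) (q : StackStmt K G Λ σ) (v : σ)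
    (S : K → List G) : ∃ c, SimCfg tr (TM2.stepAux q v S) c ∧
      Reaches₁ (configStep (simStep tr)) (.scan q v, stackQueue S ++ [none]) c := by
  induction q generalizing v S with
  | push k f q ih =>
    obtain ⟨c, hc, h⟩ := ih v (Function.update S k (f v :: S k))
    exact ⟨c, hc, (simulate_push tr k f q v S).trans h⟩
  | peek k f q ih =>
    obtain ⟨c, hc, h⟩ := ih (f v (S k).head?) S
    exact ⟨c, hc, (simulate_peek tr k f q v S).trans h⟩
  | pop k f q ih =>
    obtain ⟨c, hc, h⟩ := ih (f v (S k).head?) (Function.update S k (S k).tail)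
    exact ⟨c, hc, (simulate_pop tr k f q v S).trans h⟩
  | load a q ih =>
    obtain ⟨c, hc, h⟩ := ih (a v) S
    exact ⟨c, hc, (simulate_pass tr S fun _ => rfl).trans h⟩
  | branch f q₁ q₂ ih₁ ih₂ =>
    have h := simulate_pass tr (p := .scan (.branch f q₁ q₂) v) S fun _ => rfl
    rw [TM2.stepAux]
    revert h
    cases f v with
    | true =>
      intro h
      obtain ⟨c, hc, h'⟩ := ih₁ v S
      exact ⟨c, hc, h.trans h'⟩
    | false =>
      intro h
      obtain ⟨c, hc, h'⟩ := ih₂ v S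
      exact ⟨c, hc, h.trans h'⟩
  | goto l => exact ⟨_, rfl, simulate_pass tr S fun _ => rfl⟩
  | halt =>
    refine ⟨(.scan .halt v, []), rfl, ?_⟩
    rcases Relation.reflTransGen_iff_eq_or_transGen.1
      (simulate_halt tr v (stackQueue S ++ [none])) with h | h
    · simp at h
    · exact h

theorem respects_simStep (tr : Λ → StackStmt K G Λ σ) :
    Respects (TM2.step tr) (configStep (simStep tr)) (SimCfg tr) := by
  rintro ⟨_ | l, v, S⟩ c h
  · obtain ⟨p, w⟩ := c
    obtain rfl : w = [] := h
    rfl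
  · obtain rfl : c = _ := h
    exact simulate_stepAux tr (tr l) v S

end StackMachine

/-! ### A queue machine with an undecidable halting problem -/

/-- Halting on powers of two is undecidable for some fixed program. Powers of two have binary
representations that are as simple as unary representations. -/
theorem exists_code_undecidable :
    ∃ c : ToPartrec.Code, ¬ ComputablePred fun n : ℕ => (c.eval [2 ^ n]).Dom := by
  -- On `2 ^ k`, `f` runs the program with number `k`.
  let f : ℕ →. ℕ := fun m => (Nat.rfind fun k => Part.some (decide (2 ^ k = m))).bind fun k =>
    Nat.Partrec.Code.eval (Denumerable.ofNat Nat.Partrec.Code k) 0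
  have hpow : Primrec fun k : ℕ => 2 ^ k :=
    (Primrec.nat_iff.2 (Nat.Primrec.pow)).comp
      (Primrec₂.natPair.comp (Primrec.const 2) Primrec.id) |>.of_eq fun k => by simp
  have hf : Partrec f := by
    refine Partrec.bind (Partrec.rfind ?_) ?_
    · exact (Primrec.eq.decide.comp (hpow.comp Primrec.snd) Primrec.fst).to_comp.partrec
    · exact Nat.Partrec.Code.eval_part.comp
        ((Computable.ofNat _).comp Computable.snd) (Computable.const 0)
  have hdom : ∀ n, (f (2 ^ n)).Dom ↔
      (Nat.Partrec.Code.eval (Denumerable.ofNat Nat.Partrec.Code n) 0).Dom := by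
    intro n
    have : n ∈ Nat.rfind fun k => Part.some (decide (2 ^ k = 2 ^ n)) := by
      refine Nat.mem_rfind.2 ⟨by simp, fun {m} hm => ?_⟩
      simp [hm.ne]
    simp only [f]
    rw [Part.eq_some_iff.2 this, Part.bind_some]
  obtain ⟨c, hc⟩ := ToPartrec.Code.exists_code (Nat.Partrec'.part_iff₁.2 hf)
  refine ⟨c, fun h => ComputablePred.halting_problem 0 ?_⟩
  refine ComputablePred.computable_of_manyOneReducible (q := fun n : ℕ => (c.eval [2 ^ n]).Dom)
    ⟨Encodable.encode, Computable.encode, fun d => ?_⟩ h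
  have := hc (2 ^ Encodable.encode d ::ᵥ List.Vector.nil)
  change c.eval [_] = _ at this
  change (Nat.Partrec.Code.eval d 0).Dom ↔ (c.eval [2 ^ Encodable.encode d]).Dom
  rw [this]
  have hd := hdom (Encodable.encode d)
  rw [Denumerable.ofNat_encode] at hd
  exact hd.symm

theorem trNat_two_pow (n : ℕ) : PartrecToTM2.trNat (2 ^ n) =
    List.replicate n PartrecToTM2.Γ'.bit0 ++ [PartrecToTM2.Γ'.bit1] := by
  induction n with
  | zero => rfl
  | succ n ih =>
    rw [List.replicate_succ, List.cons_append, ← ih, PartrecToTM2.trNat, PartrecToTM2.trNat,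
      pow_succ]
    have h : ((2 ^ n * 2 : ℕ) : Num) = Num.bit0 ((2 ^ n : ℕ) : Num) := by
      rw [← Num.to_nat_inj, Num.cast_bit0, Num.to_of_nat, Num.to_of_nat]
      exact Nat.mul_comm _ _
    rw [h]
    have h0 : ((2 ^ n : ℕ) : Num) ≠ 0 := by
      rw [Ne, ← Num.to_nat_inj, Num.to_of_nat]
      exact (Nat.two_pow_pos n).ne'
    cases hn : ((2 ^ n : ℕ) : Num) with
    | zero => exact (h0 hn).elim
    | pos m => rfl

instance fintypeStackIndex : Fintype PartrecToTM2.K' :=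
  ⟨{.main, .rev, .aux, .stack}, by rintro (_ | _ | _ | _) <;> simp⟩

/-- Some queue machine has an undecidable halting problem, even for initial queues that depend on
the length of one block of equal symbols only. -/
theorem exists_queueMachine_undecidable [Infinite Tag] :
    ∃ (M : QueueMachine Tag) (u v : List M.Sym) (A : M.Sym),
      ¬ ComputablePred fun n : ℕ => M.Halts M.start (u ++ List.replicate n A ++ v) := by
  obtain ⟨c, hc⟩ := exists_code_undecidable
  let Λ := PartrecToTM2.Λ'
  let l₀ : Λ := PartrecToTM2.trNormal c .halt
  let _ : Inhabited Λ := ⟨l₀⟩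
  have hS : TM2.Supports PartrecToTM2.tr (PartrecToTM2.codeSupp c .halt) :=
    PartrecToTM2.tr_supports c .halt
  let A := StackSym PartrecToTM2.K' PartrecToTM2.Γ'
  let e : A ↪ Tag := ((Fintype.equivFin A).toEmbedding.trans Fin.valEmbedding).trans
    (Infinite.natEmbedding Tag)
  let δ := simStep PartrecToTM2.tr
  let P := {p : SimState (StackStmt PartrecToTM2.K' PartrecToTM2.Γ' Λ (Option PartrecToTM2.Γ'))
    (Option PartrecToTM2.Γ') |
      p.stmt ∈ {q | some q ∈ TM2.stmts PartrecToTM2.tr (PartrecToTM2.codeSupp c .halt)}}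
  have hP : P.Finite := SimState.finite_of_stmt
    ((Finset.finite_toSet _).preimage (Option.some_injective _).injOn)
  have hδ : ∀ p ∈ P, ∀ a, (δ p a).1 ∈ P := fun p hp a => simStep_stmt_mem hS p hp a
  have hs : SimState.scan (PartrecToTM2.tr l₀) none ∈ P := by
    simp only [P, TM2.stmts, Finset.mem_insertNone, Finset.mem_biUnion,
      Option.mem_def, Option.some.injEq, forall_eq']
    exact ⟨l₀, hS.1, TM2.stmts₁_self⟩
  obtain ⟨l₁, l₂, -, -, -, -, hsplit⟩ :=
    stackQueue_split (fun _ => [] : PartrecToTM2.K' → List PartrecToTM2.Γ') .main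
  let E := QueueMachine.ofStepSym e δ none P hP hδ _ hs
  let mainMark : A := some (.inl .main)
  let digit₀ : A := some (.inr .bit0)
  let digit₁ : A := some (.inr .bit1)
  let sep : A := some (.inr .cons)
  refine ⟨QueueMachine.ofStep e δ none P hP hδ _ hs, (l₁ ++ [mainMark]).map E,
    ([digit₁, sep] ++ l₂ ++ [none]).map E, E digit₀, fun h => hc (h.of_eq fun n => ?_)⟩
  have hq : (l₁ ++ [mainMark]).map E ++ List.replicate n (E digit₀) ++
      ([digit₁, sep] ++ l₂ ++ [none]).map E =
      (stackQueue (PartrecToTM2.K'.elim (PartrecToTM2.trList [2 ^ n]) [] [] []) ++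
        [none]).map E := by
    have hk : PartrecToTM2.K'.elim (PartrecToTM2.trList [2 ^ n]) [] [] [] =
        Function.update (fun _ => []) .main (PartrecToTM2.trList [2 ^ n]) := by
      funext k
      cases k <;> rfl
    rw [hk, hsplit]
    simp [trNat_two_pow, mainMark, digit₀, digit₁, sep]
  rw [hq]
  refine (QueueMachine.ofStep_halts_iff e δ none P hP hδ _ hs ⟨_, hs⟩ _).trans ?_
  refine (tr_eval_dom (respects_simStep PartrecToTM2.tr)
    (a₁ := PartrecToTM2.init c [2 ^ n]) rfl).trans ?_
  have := PartrecToTM2.tr_eval c [2 ^ n]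
  exact (congrArg Part.Dom this).to_iff

/-! ### Computing presentations -/

section Presentations

/-- The dual right-hand side. -/
def Node.dual (N : Node Tag) : Node Tag :=
  (Node.equiv Tag).symm (!(Node.equiv Tag N).1, (Node.equiv Tag N).2)

theorem Node.wellFormed_dual {n : ℕ} {N : Node Tag} (h : N.WellFormed n) :
    N.dual.WellFormed n := by
  cases N <;> exact h

theorem Node.Describes.dual {τ : ℕ → SessionType Tag} {N : Node Tag} {S : SessionType Tag}
    (h : N.Describes τ S) : N.dual.Describes (fun i => (τ i).dual) S.dual := by
  cases N with
  | one => exact (congrArg _ h).trans dual_one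
  | bot => exact (congrArg _ h).trans dual_bot
  | plus bs =>
    obtain ⟨I, hI, f, rfl, h₁, h₂⟩ := h
    exact ⟨I, hI, _, dual_plus _ _ _, h₁, fun a i hi => congrArg _ (h₂ a i hi)⟩
  | wth bs =>
    obtain ⟨I, hI, f, rfl, h₁, h₂⟩ := h
    exact ⟨I, hI, _, dual_wth _ _ _, h₁, fun a i hi => congrArg _ (h₂ a i hi)⟩
  | tensor i j => exact (congrArg _ h).trans (dual_tensor _ _)
  | par i j => exact (congrArg _ h).trans (dual_par _ _)

/-- The dual system of equations. -/
def Presentation.dual (P : Presentation Tag) : Presentation Tag := (P.1.map Node.dual, P.2)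

theorem Presents.dual {P : Presentation Tag} {S : SessionType Tag} (h : Presents P S) :
    Presents (Presentation.dual P) S.dual := by
  obtain ⟨⟨h₀, h₁⟩, τ, h₂, rfl⟩ := h
  refine ⟨⟨by simpa [Presentation.dual] using h₀, fun N hN => ?_⟩, fun i => (τ i).dual,
    fun i N hN => ?_, rfl⟩
  · obtain ⟨N, hN', rfl⟩ := List.mem_map.1 hN
    simpa [Presentation.dual] using Node.wellFormed_dual (h₁ N hN')
  · obtain ⟨N, hN', rfl⟩ := Option.map_eq_some_iff.1 (List.getElem?_map ▸ hN)
    exact (h₂ i N hN').dual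

/-- Appends an equation for `⊕{a : S}` to a presentation of `S`, and makes it the initial one. -/
def Presentation.send (a : Tag) (P : Presentation Tag) : Presentation Tag :=
  (P.1 ++ [.plus [(a, P.2)]], P.1.length)

theorem Node.WellFormed.mono {n m : ℕ} (hnm : n ≤ m) {N : Node Tag} (h : N.WellFormed n) :
    N.WellFormed m := by
  cases N with
  | one => trivial
  | bot => trivial
  | plus bs => exact ⟨h.1, h.2.1, fun b hb => (h.2.2 b hb).trans_le hnm⟩
  | wth bs => exact ⟨h.1, h.2.1, fun b hb => (h.2.2 b hb).trans_le hnm⟩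
  | tensor i j => exact ⟨h.1.trans_le hnm, h.2.trans_le hnm⟩
  | par i j => exact ⟨h.1.trans_le hnm, h.2.trans_le hnm⟩

theorem Node.Describes.congr {n : ℕ} {τ τ' : ℕ → SessionType Tag} (hτ : ∀ i < n, τ i = τ' i)
    {N : Node Tag} (hN : N.WellFormed n) {S : SessionType Tag} (h : N.Describes τ S) :
    N.Describes τ' S := by
  cases N with
  | one => exact h
  | bot => exact h
  | plus bs =>
    obtain ⟨I, hI, f, h₀, h₁, h₂⟩ := h
    exact ⟨I, hI, f, h₀, h₁, fun a i hi => (h₂ a i hi).trans (hτ i (hN.2.2 _ hi))⟩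
  | wth bs =>
    obtain ⟨I, hI, f, h₀, h₁, h₂⟩ := h
    exact ⟨I, hI, f, h₀, h₁, fun a i hi => (h₂ a i hi).trans (hτ i (hN.2.2 _ hi))⟩
  | tensor i j => rw [Node.Describes, ← hτ i hN.1, ← hτ j hN.2]; exact h
  | par i j => rw [Node.Describes, ← hτ i hN.1, ← hτ j hN.2]; exact h

theorem Presents.send {P : Presentation Tag} {S : SessionType Tag} (h : Presents P S) (a : Tag) :
    Presents (Presentation.send a P) (SessionType.send a S) := by
  obtain ⟨⟨h₀, h₁⟩, τ, h₂, rfl⟩ := h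
  have hτ : ∀ i < P.1.length, τ i =
      Function.update τ P.1.length (SessionType.send a (τ P.2)) i := fun i hi =>
    (Function.update_of_ne hi.ne _ _).symm
  refine ⟨⟨by simp [Presentation.send], fun N hN => ?_⟩,
    Function.update τ P.1.length (SessionType.send a (τ P.2)), fun i N hN => ?_,
    Function.update_self _ _ _⟩
  · rw [Presentation.send, List.length_append, List.length_singleton]
    rcases List.mem_append.1 hN with hN | hN
    · exact (h₁ N hN).mono (Nat.le_succ _)
    · obtain rfl := List.mem_singleton.1 hN
      exact ⟨by simp, by simp, by simpa using h₀.le⟩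
  · rcases lt_or_ge i P.1.length with hi | hi
    · rw [← hτ i hi]
      rw [Presentation.send, List.getElem?_append_left hi] at hN
      exact (h₂ i N hN).congr hτ (h₁ N (List.mem_of_getElem? hN))
    · rw [Presentation.send, List.getElem?_append_right hi, List.getElem?_singleton] at hN
      split_ifs at hN with h
      obtain rfl : i = P.1.length := by omega
      obtain rfl := Option.some.inj hN
      rw [Function.update_self]
      refine ⟨_, _, _, rfl, by simp, fun b i hi => ?_⟩
      obtain rfl : i = P.2 := congrArg Prod.snd (List.mem_singleton.1 hi)
      exact hτ _ h₀

theorem presents_queueType {M : QueueMachine Tag} {P : Presentation Tag}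
    (hP : Presents P M.queueLoop) (w : List M.Sym) :
    Presents ((w.map Subtype.val).foldr Presentation.send P) (M.queueType w) := by
  induction w with
  | nil => exact hP
  | cons A w ih => exact ih.send A.1

variable [Primcodable Tag]

theorem primrec_dual : Primrec (Presentation.dual (Tag := Tag)) := by
  have he : Primrec (Node.equiv Tag) := Primrec.of_equiv
  have he' : Primrec (Node.equiv Tag).symm := Primrec.of_equiv_symm
  have hN : Primrec (Node.dual (Tag := Tag)) :=
    he'.comp ((Primrec.not.comp (Primrec.fst.comp he)).pair (Primrec.snd.comp he))
  exact (Primrec.list_map Primrec.fst (hN.comp Primrec.snd).to₂).pair Primrec.snd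

theorem primrec_send : Primrec₂ (Presentation.send (Tag := Tag)) := by
  have he' : Primrec (Node.equiv Tag).symm := Primrec.of_equiv_symm
  have hplus : Primrec (Node.plus (Tag := Tag)) :=
    he'.comp ((Primrec.const true).pair (Primrec.sumInr.comp Primrec.sumInl))
  have h₁ : Primrec fun x : Tag × Presentation Tag => x.2.1 := Primrec.fst.comp Primrec.snd
  have h₂ : Primrec fun x : Tag × Presentation Tag => [(x.1, x.2.2)] :=
    Primrec.list_cons.comp (Primrec.fst.pair (Primrec.snd.comp Primrec.snd)) (Primrec.const [])
  exact (Primrec.list_append.comp h₁ (Primrec.list_cons.comp (hplus.comp h₂)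
    (Primrec.const []))).pair (Primrec.list_length.comp h₁)

theorem primrec_foldr_send (P : Presentation Tag) :
    Primrec fun w : List Tag => w.foldr Presentation.send P :=
  Primrec.list_foldr Primrec.id (Primrec.const P)
    (primrec_send.comp (Primrec.fst.comp Primrec.snd) (Primrec.snd.comp Primrec.snd)).to₂

theorem primrec_replicate (a : Tag) : Primrec fun n : ℕ => List.replicate n a :=
  (Primrec.list_map Primrec.list_range (Primrec.const a).to₂).of_eq fun n => by simp

theorem not_decidable_correct [Infinite Tag] :
    ¬ DecidableOnPresentations (Correct (Tag := Tag)) := by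
  rintro ⟨p, hp, h⟩
  obtain ⟨M, u, v, A, hM⟩ := exists_queueMachine_undecidable (Tag := Tag)
  obtain ⟨P, hP⟩ := exists_presents M.queueLoop
  obtain ⟨Q, hQ⟩ := exists_presents (M.controlType M.start)
  let F : ℕ → Presentation Tag × Presentation Tag := fun n =>
    ((u.map Subtype.val ++ List.replicate n A.1 ++ v.map Subtype.val).foldr Presentation.send P, Q)
  have hF : Primrec F := ((primrec_foldr_send P).comp (Primrec.list_append.comp
    (Primrec.list_append.comp (Primrec.const _) (primrec_replicate A.1)) (Primrec.const _))).pair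
      (Primrec.const Q)
  have hpF : ComputablePred fun n => p (F n) :=
    ComputablePred.computable_of_manyOneReducible ⟨F, hF.to_comp, fun _ => Iff.rfl⟩ hp
  refine hM (hpF.not.of_eq fun n => ?_)
  rw [h (F n).1 Q (M.queueType (u ++ List.replicate n A ++ v)) _ ?_ hQ,
    M.correct_iff_not_halts, not_not]
  simpa [F] using presents_queueType hP (u ++ List.replicate n A ++ v)

theorem not_decidable_subtyping [Infinite Tag] :
    ¬ DecidableOnPresentations (Subtyping (Tag := Tag)) := by
  rintro ⟨p, hp, h⟩
  have hF : Primrec fun x : Presentation Tag × Presentation Tag => (x.2, Presentation.dual x.1) :=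
    Primrec.snd.pair (primrec_dual.comp Primrec.fst)
  exact not_decidable_correct ⟨_,
    ComputablePred.computable_of_manyOneReducible ⟨_, hF.to_comp, fun _ => Iff.rfl⟩ hp,
    fun P Q S T hP hQ => (h _ _ _ _ hQ hP.dual).trans correct_iff_subtyping.symm⟩

end Presentations

end AsyncSession

theorem mainTheorem8 :
    (∀ (Tag : Type) (M : AsyncSession.QueueMachine Tag) (x : List {a // a ∈ M.inputAlphabet}),
      M.Accepts x ↔
        ¬ AsyncSession.Correct (M.queueType (M.initialQueue x)) (M.controlType M.start)) ∧
    (∀ (Tag : Type) [Primcodable Tag] [Infinite Tag],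
      ¬ AsyncSession.DecidableOnPresentations (AsyncSession.Correct (Tag := Tag)) ∧
      ¬ AsyncSession.DecidableOnPresentations (AsyncSession.Subtyping (Tag := Tag))) := by
  refine ⟨fun Tag M x => ?_, fun Tag _ _ =>
    ⟨AsyncSession.not_decidable_correct, AsyncSession.not_decidable_subtyping⟩⟩
  rw [M.correct_iff_not_halts, not_not]
  rfl
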